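/- **Setting.** Let $f(\cdot;\xi):\mathbb{R}^p\to\mathbb{R}$ be a loss depending on a random sample $\xi$, let $K$ clients have data laws $\mathcal P_1,\dots,\mathcal P_K$ and weights $\pi_k\ge 0$, $\sum_k\pi_k=1$, and put $\mathcal L_k(w)=\mathbb E_{\xi\sim\mathcal P_k}f(w;\xi)$, $\mathcal L=\sum_k\pi_k\mathcal L_k$, $\phi=\mathcal L+h$. The domain is the ball $\mathcal W=\{w:\|w\|_2\le\rho\}$, $\rho>0$, and $\widehat w\in\arg\min_{\mathcal W}\phi$. Assume, $f(\cdot;\xi)$ and $\mathcal L_k$ being differentiable at the points of $\mathcal W$: 1. for some $0<\mu\le L$, all $k$ and all $w,w'\in\mathcal W$: $\frac\mu2\|w-w'\|^2\le\mathcal L_k(w)-\mathcal L_k(w')-\langle\nabla\mathcal L_k(w'),w-w'\rangle\le\frac L2\|w-w'\|^2$; 2. $h$ is real-valued, convex and closed (lower semicontinuous) on $\mathcal W$; 3. for some $\Lambda>0$, $H\ge0$, all $k$ and all $w,w'\in\mathcal W$: $\|\nabla\mathcal L(w)-\nabla\mathcal L(w')\|\le\Lambda\|w-w'\|$ and $\|\nabla\mathcal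 L(w)-\nabla\mathcal L_k(w)\|\le H$; 4. for some $\sigma\ge0$, all $k$ and all $w\in\mathcal W$: $\mathbb E_{\xi\sim\mathcal P_k}\nabla f(w;\xi)=\nabla\mathcal L_k(w)$ and $\mathbb E_{\xi\sim\mathcal P_k}\|\nabla f(w;\xi)-\nabla\mathcal L_k(w)\|^2\le\sigma^2$. **Algorithm (Fast-FedDA).** Let $w_0\in\mathcal W$, $a\ge4L/\mu$, $\alpha_t=(t+a)^2$, $A_t=\sum_{i=0}^t\alpha_i$, $\gamma=2\mu a^3$, and let $E\ge1$ be an integer. Put $$\operatorname{Prox}_t(z)=\arg\min_{w\in\mathcal W}\Big\{\langle w,z-\gamma w_0\rangle+\Big(\frac{\mu A_t}{2}+\gamma\Big)\frac{\|w\|^2}{2}+A_th(w)\Big\}.$$ Start from $w_0^k=w_0$, $g_{-1}^k=0$, $\widetilde w_0^k=\alpha_0w_0$. At each step $t=0,1,2,\dots$ client $k$ draws $\xi_t^k\sim\mathcal P_k$ (all draws independent) and forms $g_t^k=g_{t-1}^k+\alpha_t\nabla f(w_t^k;\xi_t^k)$. Let $w_{t+1}=\operatorname{Prox}_t\big(\sum_k\pi_k(g_t^k-\frac\mu2\widetilde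 w_t^k)\big)$. If $E\nmid t+1$, set $w_{t+1}^k=\operatorname{Prox}_t(g_t^k-\frac\mu2\widetilde w_t^k)$ and $\widetilde w_{t+1}^k=\widetilde w_t^k+\alpha_{t+1}w_{t+1}^k$. If $E\mid t+1$ (a communication round), the server computes $w_{t+1}$, and every client receives $w_{t+1}^k=w_{t+1}$, $g_t^k\leftarrow\sum_l\pi_lg_t^l$ and $\widetilde w_{t+1}^k=\sum_l\pi_l\widetilde w_t^l+\alpha_{t+1}w_{t+1}$. The solution returned for the horizon $T$ is $\widehat w_{\text{Fast-FedDA}}=\frac1{A_T}\sum_{t=0}^T\alpha_tw_{t+1}$. **Theorem.** There is an absolute constant $c>0$ such that, with $B=\|w_0-\widehat w\|^2$ and $\bar\sigma^2=\sum_k\pi_k^2\sigma^2$, the following hold. (i) For all integers $E\ge1$ and $T\ge a$, $\phi(\widehat w_{\text{Fast-FedDA}})-\phi(\widehat w)$ is integrable and $$\mathbb E[\phi(\widehat w_{\text{Fast-FedDA}})-\phi(\widehat w)]\le c\left(\frac{\mu a^3B}{T^3}+\frac{\bar\sigma^2}{\mu T}+\frac{LE\sigma^2}{\mu^2T^2}+\frac{LE^2(H+\Lambda\rho)^2}{\mu^2T^2}\right).$$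 (ii) (Linear speedup.) Let $\pi_k=1/K$ for all $k$ and $\sigma>0$. For all $C\ge1$ and integers $E\ge1$, $T\ge a$ with $$E^2\le C\,\frac{\sigma^2\mu T}{LK(H+\Lambda\rho)^2},\qquad \frac{\mu^2a^3BK}{\sigma^2}\le C\,T^2,\qquad \frac{LK\sigma^2}{\mu(H+\Lambda\rho)^2}\le C\,T,$$ one has $\mathbb E[\phi(\widehat w_{\text{Fast-FedDA}})-\phi(\widehat w)]\le c\,C\,\frac{\sigma^2}{\mu KT}$. (iii) (Communication.) Let $\pi_k=1/K$ for all $k$ and $\sigma>0$. For every integer $T\ge a$ with $T^2\ge\frac{\mu^2a^3BK}{\sigma^2}$, $T\ge\frac{LK\sigma^2}{\mu(H+\Lambda\rho)^2}$ and $T\ge\frac{LK(H+\Lambda\rho)^2}{\mu\sigma^2}$, there is an integer $E\ge1$ for which $\mathbb E[\phi(\widehat w_{\text{Fast-FedDA}})-\phi(\widehat w)]\le c\,\frac{\sigma^2}{\mu KT}$ and the number of communication rounds during the steps $0,\dots,T$ is at most $c\,\sqrt{\frac L\mu}\,\frac{H+\Lambda\rho}{\sigma}\,\sqrt{TK}$.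 -/

import Mathlib

open MeasureTheory ProbabilityTheory

noncomputable section

namespace FedComposite

/-- The parameter space `ℝ^p` with the Euclidean norm. -/
abbrev Vec (p : ℕ) : Type := EuclideanSpace ℝ (Fin p)

/-! ### The federated composite problem -/

/-- The local population loss `ℒ(w) = 𝔼_{ξ ∼ P} f(w; ξ)` of a client with data law `P`. -/
def localLoss {p : ℕ} {S : Type*} [MeasurableSpace S] (f : Vec p → S → ℝ) (P : Measure S)
    (w : Vec p) : ℝ :=
  ∫ s, f w s ∂P

/-- The global loss `ℒ(w) = ∑ₖ πₖ ℒₖ(w)`. -/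
def globalLoss {p K : ℕ} {S : Type*} [MeasurableSpace S] (f : Vec p → S → ℝ)
    (P : Fin K → Measure S) (wt : Fin K → ℝ) (w : Vec p) : ℝ :=
  ∑ k, wt k * localLoss f (P k) w

/-- The composite objective `φ = ℒ + h`. -/
def objective {p K : ℕ} {S : Type*} [MeasurableSpace S] (f : Vec p → S → ℝ)
    (P : Fin K → Measure S) (wt : Fin K → ℝ) (h : Vec p → ℝ) (w : Vec p) : ℝ :=
  globalLoss f P wt w + h w

/-- The stochastic gradient `∇f(w; s)`, the gradient being taken in `w`. -/
def stochGrad {p : ℕ} {S : Type*} (f : Vec p → S → ℝ) (s : S) (w : Vec p) : Vec p :=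
  gradient (fun v => f v s) w

/-- `F` is differentiable at the points of `W`, `μ`-strongly convex and `L`-smooth on `W`. -/
def StronglyConvexSmoothOn {p : ℕ} (μ L : ℝ) (W : Set (Vec p)) (F : Vec p → ℝ) : Prop :=
  (∀ w ∈ W, DifferentiableAt ℝ F w) ∧
  ∀ w ∈ W, ∀ w' ∈ W,
    μ / 2 * ‖w - w'‖ ^ 2 ≤ F w - F w' - inner ℝ (gradient F w') (w - w') ∧
    F w - F w' - inner ℝ (gradient F w') (w - w') ≤ L / 2 * ‖w - w'‖ ^ 2

/-- Under the law `P` the stochastic gradient is, at every point of `W`, an unbiased estimate of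
the gradient of the local loss, with variance at most `σ²`. -/
def UnbiasedBoundedVariance {p : ℕ} {S : Type*} [MeasurableSpace S] (f : Vec p → S → ℝ)
    (P : Measure S) (W : Set (Vec p)) (σ : ℝ) : Prop :=
  ∀ w ∈ W,
    Integrable (fun s => stochGrad f s w) P ∧
    ∫ s, stochGrad f s w ∂P = gradient (localLoss f P) w ∧
    Integrable (fun s => ‖stochGrad f s w - gradient (localLoss f P) w‖ ^ 2) P ∧
    ∫ s, ‖stochGrad f s w - gradient (localLoss f P) w‖ ^ 2 ∂P ≤ σ ^ 2

/-! ### The algorithm -/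

/-- The weights `α_t = (t + a)²`. -/
def alpha (a : ℝ) (t : ℕ) : ℝ := (t + a) ^ 2

/-- The cumulative weights `A_t = α_0 + ⋯ + α_t`. -/
def cumAlpha (a : ℝ) (t : ℕ) : ℝ := ∑ i ∈ Finset.range (t + 1), alpha a i

/-- The inputs of Fast-FedDA: client weights `πₖ`, domain `𝒲`, regularizer `h`, initial point
`w₀`, number `E` of local steps between two synchronizations, and the constants `μ`, `γ`, `a`. -/
structure Input (p K : ℕ) where
  wt : Fin K → ℝ
  dom : Set (Vec p)
  reg : Vec p → ℝ
  init : Vec p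
  gap : ℕ
  μ : ℝ
  γ : ℝ
  a : ℝ

variable {p K : ℕ}

/-- The function minimized by the proximal operator,
`⟨w, z - γ w₀⟩ + (μ A_t / 2 + γ) ‖w‖² / 2 + A_t h(w)`. -/
def proxObj (I : Input p K) (t : ℕ) (z w : Vec p) : ℝ :=
  inner ℝ w (z - I.γ • I.init) + (I.μ * cumAlpha I.a t / 2 + I.γ) * (‖w‖ ^ 2 / 2)
    + cumAlpha I.a t * I.reg w

/-- `Prox_t(z)`: the minimizer of `proxObj I t z` over the domain. It exists and is unique for
`μ, γ > 0` and a nonempty compact convex domain carrying a closed convex regularizer. -/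
def prox (I : Input p K) (t : ℕ) (z : Vec p) : Vec p :=
  Classical.epsilon fun w => w ∈ I.dom ∧ IsMinOn (proxObj I t z) I.dom w

/-- The state of the `K` clients when step `t` begins: the local solutions `w_t^k`, the sums
`g_{t-1}^k` of weighted past stochastic gradients, and the sums `w̃_t^k` of weighted past
solutions (`w_t^k` included). -/
structure State (p K : ℕ) where
  sol : Fin K → Vec p
  grad : Fin K → Vec p
  sum : Fin K → Vec p

/-- The state at `t = 0`. -/
def initState (I : Input p K) : State p K where
  sol := fun _ => I.init
  grad := fun _ => 0
  sum := fun _ => alpha I.a 0 • I.init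

/-- `g_t^k = g_{t-1}^k + α_t G_t^k`, where `G_t^k` is the value of the gradient oracle `O k` of
client `k` at its current local solution. -/
def newGrad (I : Input p K) (t : ℕ) (O : Fin K → Vec p → Vec p) (s : State p K) (k : Fin K) :
    Vec p :=
  s.grad k + alpha I.a t • O k (s.sol k)

/-- The aggregated solution `w_{t+1} = Prox_t(∑ₖ πₖ (g_t^k - μ w̃_t^k / 2))`. It is the solution
computed by the server when `t + 1` is a synchronization time. -/
def aggregate (I : Input p K) (t : ℕ) (O : Fin K → Vec p → Vec p) (s : State p K) : Vec p :=
  prox I t (∑ k, I.wt k • (newGrad I t O s k - (I.μ / 2) • s.sum k))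

/-- One step of the algorithm, from time `t` to time `t + 1`: the server aggregates, updates and
broadcasts if `t + 1` is a multiple of `E`, and each client makes a local update otherwise. -/
def step (I : Input p K) (t : ℕ) (O : Fin K → Vec p → Vec p) (s : State p K) : State p K :=
  if I.gap ∣ t + 1 then
    { sol := fun _ => aggregate I t O s
      grad := fun _ => ∑ k, I.wt k • newGrad I t O s k
      sum := fun _ => (∑ k, I.wt k • s.sum k) + alpha I.a (t + 1) • aggregate I t O s }
  else
    { sol := fun k => prox I t (newGrad I t O s k - (I.μ / 2) • s.sum k)
      grad := fun k => newGrad I t O s k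
      sum := fun k => s.sum k
        + alpha I.a (t + 1) • prox I t (newGrad I t O s k - (I.μ / 2) • s.sum k) }

/-- The state at time `t`, when client `k` uses the oracle `O i k` at step `i`. -/
def run (I : Input p K) (O : ℕ → Fin K → Vec p → Vec p) : ℕ → State p K
  | 0 => initState I
  | t + 1 => step I t (O t) (run I O t)

/-- The returned solution, the average `∑_{t=0}^T α_t w_{t+1} / A_T` of aggregated solutions. -/
def output (I : Input p K) (O : ℕ → Fin K → Vec p → Vec p) (T : ℕ) : Vec p :=
  (cumAlpha I.a T)⁻¹ •
    ∑ t ∈ Finset.range (T + 1), alpha I.a t • aggregate I t (O t) (run I O t)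

/-- The returned solution of Fast-FedDA on the loss `f` when client `k` draws the sample `x t k`
at step `t`. -/
def fastFedDA {S : Type*} (I : Input p K) (f : Vec p → S → ℝ) (x : ℕ → Fin K → S) (T : ℕ) :
    Vec p :=
  output I (fun t k => stochGrad f (x t k)) T

/-- The suboptimality `φ(ŵ) - φ(wmin)` of the solution `ŵ` returned by Fast-FedDA with
`γ = 2 μ a³`, synchronization gap `E` and horizon `T`, as a random variable; `x t k` is the sample
that client `k` draws at step `t`. -/
def suboptimality {S Ω : Type*} [MeasurableSpace S] (f : Vec p → S → ℝ) (P : Fin K → Measure S)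
    (wt : Fin K → ℝ) (W : Set (Vec p)) (h : Vec p → ℝ) (w₀ : Vec p) (μ a : ℝ)
    (x : ℕ → Fin K → Ω → S) (wmin : Vec p) (E T : ℕ) (ω : Ω) : ℝ :=
  objective f P wt h
      (fastFedDA
        { wt := wt, dom := W, reg := h, init := w₀, gap := E, μ := μ, γ := 2 * μ * a ^ 3, a := a }
        f (fun t k => x t k ω) T)
    - objective f P wt h wmin

/-- The number of communication rounds, i.e. of server aggregations, among the steps
`t = 0, …, T`, when the server aggregates at the end of every `E`-th step. -/
def commRounds (E T : ℕ) : ℕ := ((Finset.range (T + 1)).filter fun t => E ∣ t + 1).card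

end FedComposite

end

namespace FedComposite

/-! Averaged over the clients, Fast-FedDA is dual averaging. Synchronization replaces vectors by
their weighted means, so the recursions for the means do not see it (`wmean_proxArg`). The
aggregated point w_{t+1} therefore minimizes γ/2 ‖w - w₀‖² plus α_i-weighted quadratic models, built
at the mean local points from the mean stochastic gradients. This function grows quadratically
around its minimizer, with coefficient m_{t+1}, where m_t, the `modulus`, is at least μ(t+a)³/24.
Telescoping yields a regret bound that also controls ∑ m_t ‖w_{t+1} - w_t‖²
(`dual_averaging_regret`).

Smoothness and strong convexity bound the objective gap at w_{t+1} by the model gap, a noise term,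
and L times the squared movement plus the client discrepancy (`objective_sub_le_lowerModel`). The
conditions on a and γ give α_t L ≤ 7/8 m_t. The movement terms thus pay for smoothness, and the
remaining 1/8 pays for the noise along w_{t+1} - w_t. The noise along u - w_t has mean zero, since
w_t is determined before the samples of step t (`weighted_objective_sub_le`).

Off synchronization, a local and the aggregated solution are values of one proximal map, Lipschitz
with constant 1/(2m), at arguments that differ by at most E terms accumulated since the last
synchronization. The noise in these terms is orthogonal in L² and costs Eσ²; the drift costs
E²(H+Λρ)². Hence α_t times the expected discrepancy is O((Eσ² + E²(H+Λρ)²)/μ²) uniformly in t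
(`SamplingModel.integral_discrepancy_le`). The averaged noise has second moment at most ∑ π_k² σ².
Summing and dividing by A_T ≥ T³/3 gives the rate; speedup and communication follow by arithmetic.
-/

variable {p K : ℕ}

/-! ### Admissible inputs and the proximal operator -/

/-- The standing assumptions on the inputs of Fast-FedDA. -/
structure Input.Admissible (I : Input p K) : Prop where
  wt_nonneg : ∀ k, 0 ≤ I.wt k
  wt_sum : ∑ k, I.wt k = 1
  isCompact : IsCompact I.dom
  init_mem : I.init ∈ I.dom
  convexOn : ConvexOn ℝ I.dom I.reg
  lsc : LowerSemicontinuousOn I.reg I.dom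
  μ_pos : 0 < I.μ
  γ_pos : 0 < I.γ
  a_pos : 0 < I.a

/-- Half of the strong convexity modulus of the objective defining the `n`-th server solution. -/
noncomputable def modulus (I : Input p K) (n : ℕ) : ℝ :=
  I.μ * (∑ i ∈ Finset.range n, alpha I.a i) / 4 + I.γ / 2

theorem alpha_nonneg (a : ℝ) (t : ℕ) : 0 ≤ alpha a t := sq_nonneg _

theorem alpha_pos {a : ℝ} (ha : 0 < a) (t : ℕ) : 0 < alpha a t := by
  unfold alpha; positivity

theorem cumAlpha_pos {a : ℝ} (ha : 0 < a) (t : ℕ) : 0 < cumAlpha a t :=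
  Finset.sum_pos (fun i _ => alpha_pos ha i) ⟨0, by simp⟩

theorem modulus_succ (I : Input p K) (t : ℕ) :
    modulus I (t + 1) = I.μ * cumAlpha I.a t / 4 + I.γ / 2 := rfl

namespace Input.Admissible

variable {I : Input p K}

theorem modulus_pos (hI : I.Admissible) (n : ℕ) : 0 < modulus I n := by
  have h1 : 0 ≤ ∑ i ∈ Finset.range n, alpha I.a i := Finset.sum_nonneg fun i _ => alpha_nonneg _ _
  have := hI.μ_pos
  have := hI.γ_pos
  unfold modulus
  positivity

theorem convex (hI : I.Admissible) : Convex ℝ I.dom := hI.convexOn.1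

theorem wmean_mem (hI : I.Admissible) {v : Fin K → Vec p} (hv : ∀ k, v k ∈ I.dom) :
    ∑ k, I.wt k • v k ∈ I.dom :=
  hI.convex.sum_mem (fun k _ => hI.wt_nonneg k) hI.wt_sum fun k _ => hv k

theorem proxObj_lsc (hI : I.Admissible) (t : ℕ) (z : Vec p) :
    LowerSemicontinuousOn (proxObj I t z) I.dom := by
  have hc := cumAlpha_pos hI.a_pos t
  have h1 : LowerSemicontinuousOn (fun w => cumAlpha I.a t * I.reg w) I.dom := by
    have := (continuous_const_mul (cumAlpha I.a t)).comp_lowerSemicontinuousOn hI.lsc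
      (monotone_mul_left_of_nonneg hc.le)
    exact this
  refine LowerSemicontinuousOn.add (Continuous.continuousOn ?_).lowerSemicontinuousOn h1
  fun_prop

theorem exists_isMinOn_proxObj (hI : I.Admissible) (t : ℕ) (z : Vec p) :
    ∃ w, w ∈ I.dom ∧ IsMinOn (proxObj I t z) I.dom w :=
  (hI.proxObj_lsc t z).exists_isMinOn ⟨_, hI.init_mem⟩ hI.isCompact

theorem prox_mem (hI : I.Admissible) (t : ℕ) (z : Vec p) : prox I t z ∈ I.dom :=
  (Classical.epsilon_spec (hI.exists_isMinOn_proxObj t z)).1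

theorem isMinOn_prox (hI : I.Admissible) (t : ℕ) (z : Vec p) :
    IsMinOn (proxObj I t z) I.dom (prox I t z) :=
  (Classical.epsilon_spec (hI.exists_isMinOn_proxObj t z)).2

theorem proxObj_segment_le (hI : I.Admissible) (t : ℕ) (z : Vec p) {u v : Vec p}
    (hu : u ∈ I.dom) (hv : v ∈ I.dom) {θ : ℝ} (h0 : 0 ≤ θ) (h1 : θ ≤ 1) :
    proxObj I t z ((1 - θ) • u + θ • v) ≤ (1 - θ) * proxObj I t z u + θ * proxObj I t z v
      - modulus I (t + 1) * (θ * (1 - θ) * ‖v - u‖ ^ 2) := by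
  have hc := cumAlpha_pos hI.a_pos t
  have hh := hI.convexOn.2 hu hv (sub_nonneg.2 h1) h0 (by ring)
  have hh2 := mul_le_mul_of_nonneg_left hh hc.le
  have hn : ‖(1 - θ) • u + θ • v‖ ^ 2 = (1 - θ) * ‖u‖ ^ 2 + θ * ‖v‖ ^ 2
      - θ * (1 - θ) * ‖v - u‖ ^ 2 := by
    rw [norm_add_sq_real, norm_sub_sq_real, norm_smul, norm_smul, real_inner_smul_left,
      real_inner_smul_right, mul_pow, mul_pow, Real.norm_eq_abs, Real.norm_eq_abs, sq_abs, sq_abs,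
      real_inner_comm u v]
    ring
  have hi : inner ℝ ((1 - θ) • u + θ • v) (z - I.γ • I.init)
      = (1 - θ) * inner ℝ u (z - I.γ • I.init) + θ * inner ℝ v (z - I.γ • I.init) := by
    rw [inner_add_left, real_inner_smul_left, real_inner_smul_left]
  unfold proxObj
  rw [hn, hi, modulus_succ]
  simp only [smul_eq_mul] at hh2
  linarith

/-- Compare the minimizer with the point at parameter θ on the segment to `w`, divide by θ and let θ
→ 0. No subgradient of the regularizer is needed. -/
theorem prox_growth (hI : I.Admissible) (t : ℕ) (z : Vec p) {w : Vec p} (hw : w ∈ I.dom) :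
    proxObj I t z (prox I t z) + modulus I (t + 1) * ‖w - prox I t z‖ ^ 2 ≤ proxObj I t z w := by
  set u := prox I t z
  have hu : u ∈ I.dom := hI.prox_mem t z
  have key : ∀ θ : ℝ, θ ∈ Set.Ioo (0 : ℝ) 1 →
      proxObj I t z u + modulus I (t + 1) * ((1 - θ) * ‖w - u‖ ^ 2) ≤ proxObj I t z w := by
    intro θ hθ
    have h1 := hI.proxObj_segment_le t z hu hw hθ.1.le hθ.2.le
    have h2 : proxObj I t z u ≤ proxObj I t z ((1 - θ) • u + θ • w) :=
      hI.isMinOn_prox t z (hI.convex hu hw (sub_nonneg.2 hθ.2.le) hθ.1.le (by ring))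
    have h3 : 0 ≤ θ * (proxObj I t z w - proxObj I t z u
        - modulus I (t + 1) * ((1 - θ) * ‖w - u‖ ^ 2)) := by linarith
    have := nonneg_of_mul_nonneg_right h3 hθ.1
    linarith
  have hlim : Filter.Tendsto (fun θ : ℝ => proxObj I t z u
      + modulus I (t + 1) * ((1 - θ) * ‖w - u‖ ^ 2)) (nhdsWithin 0 (Set.Ioi 0))
      (nhds (proxObj I t z u + modulus I (t + 1) * ((1 - 0) * ‖w - u‖ ^ 2))) := by
    refine (Continuous.tendsto ?_ 0).mono_left nhdsWithin_le_nhds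
    fun_prop
  have := le_of_tendsto hlim (Filter.mem_of_superset (Ioo_mem_nhdsGT one_pos) key)
  simpa using this

/-- Adding the growth inequalities of the two minimizers cancels everything except an inner product
with `z - z'`. -/
theorem norm_prox_sub_le (hI : I.Admissible) (t : ℕ) (z z' : Vec p) :
    2 * modulus I (t + 1) * ‖prox I t z - prox I t z'‖ ≤ ‖z - z'‖ := by
  set u := prox I t z
  set v := prox I t z'
  have h1 : proxObj I t z u + modulus I (t + 1) * ‖v - u‖ ^ 2 ≤ proxObj I t z v :=
    hI.prox_growth t z (hI.prox_mem t z')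
  have h2 : proxObj I t z' v + modulus I (t + 1) * ‖u - v‖ ^ 2 ≤ proxObj I t z' u :=
    hI.prox_growth t z' (hI.prox_mem t z)
  rw [norm_sub_rev] at h1
  have h3 : proxObj I t z v - proxObj I t z u + (proxObj I t z' u - proxObj I t z' v)
      = inner ℝ (v - u) (z - z') := by
    unfold proxObj
    simp only [inner_sub_left, inner_sub_right]
    ring
  have h4 : inner ℝ (v - u) (z - z') ≤ ‖u - v‖ * ‖z - z'‖ := by
    rw [norm_sub_rev u v]; exact real_inner_le_norm _ _
  have h5 : 2 * modulus I (t + 1) * ‖u - v‖ * ‖u - v‖ ≤ ‖z - z'‖ * ‖u - v‖ := by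
    nlinarith
  rcases (norm_nonneg (u - v)).eq_or_lt with h0 | h0
  · rw [← h0]; simp
  · exact le_of_mul_le_mul_right h5 h0

/-- As `prox` is chosen by `Classical.epsilon`, the measurability of the iterates rests on this
continuity. -/
theorem continuous_prox (hI : I.Admissible) (t : ℕ) : Continuous (prox I t) := by
  have hm := hI.modulus_pos (t + 1)
  refine (LipschitzWith.of_dist_le_mul (K := (2 * modulus I (t + 1))⁻¹.toNNReal) ?_).continuous
  intro z z'
  rw [dist_eq_norm, dist_eq_norm, Real.coe_toNNReal _ (by positivity), inv_mul_eq_div,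
    le_div_iff₀ (by positivity), mul_comm]
  exact hI.norm_prox_sub_le t z z'

end Input.Admissible

/-! ### Weighted averages over the clients -/

/-- The weighted average of vectors held by the clients. -/
noncomputable def Input.wmean (I : Input p K) (v : Fin K → Vec p) : Vec p := ∑ k, I.wt k • v k

/-- The local solutions `w_t^k`. -/
noncomputable def localSol (I : Input p K) (O : ℕ → Fin K → Vec p → Vec p) (t : ℕ) (k : Fin K) :
    Vec p :=
  (run I O t).sol k

/-- The aggregated solutions `w_t`, including those that the server does not compute. -/
noncomputable def serverSol (I : Input p K) (O : ℕ → Fin K → Vec p → Vec p) : ℕ → Vec p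
  | 0 => I.init
  | t + 1 => aggregate I t (O t) (run I O t)

/-- The stochastic gradient used by client `k` at step `t`. -/
noncomputable def usedGrad (I : Input p K) (O : ℕ → Fin K → Vec p → Vec p) (t : ℕ) (k : Fin K) :
    Vec p :=
  O t k (localSol I O t k)

/-- The argument of the proximal operator of client `k` at step `t`. -/
noncomputable def proxArg (I : Input p K) (O : ℕ → Fin K → Vec p → Vec p) (t : ℕ) (k : Fin K) :
    Vec p :=
  newGrad I t (O t) (run I O t) k - (I.μ / 2) • (run I O t).sum k

section wmean

variable (I : Input p K)

theorem wmean_add (u v : Fin K → Vec p) :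
    I.wmean (fun k => u k + v k) = I.wmean u + I.wmean v := by
  simp [Input.wmean, Finset.sum_add_distrib]

theorem wmean_sub (u v : Fin K → Vec p) :
    I.wmean (fun k => u k - v k) = I.wmean u - I.wmean v := by
  simp [Input.wmean, smul_sub, Finset.sum_sub_distrib]

theorem wmean_smul (c : ℝ) (v : Fin K → Vec p) :
    I.wmean (fun k => c • v k) = c • I.wmean v := by
  simp only [Input.wmean, Finset.smul_sum]
  exact Finset.sum_congr rfl fun k _ => smul_comm _ _ _

theorem wmean_const (hI : ∑ k, I.wt k = 1) (v : Vec p) : I.wmean (fun _ => v) = v := by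
  rw [Input.wmean, ← Finset.sum_smul, hI, one_smul]

theorem norm_wmean_le (hI : I.Admissible) {v : Fin K → Vec p} {C : ℝ} (hv : ∀ k, ‖v k‖ ≤ C) :
    ‖I.wmean v‖ ≤ C := by
  calc ‖I.wmean v‖ ≤ ∑ k, ‖I.wt k • v k‖ := norm_sum_le _ _
    _ ≤ ∑ k, I.wt k * C := by
        refine Finset.sum_le_sum fun k _ => ?_
        rw [norm_smul, Real.norm_eq_abs, abs_of_nonneg (hI.wt_nonneg k)]
        exact mul_le_mul_of_nonneg_left (hv k) (hI.wt_nonneg k)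
    _ = C := by rw [← Finset.sum_mul, hI.wt_sum, one_mul]

theorem norm_sub_wmean_le (hI : I.Admissible) {v : Fin K → Vec p} {C : ℝ}
    (hv : ∀ k l, ‖v k - v l‖ ≤ C) (k : Fin K) : ‖v k - I.wmean v‖ ≤ C := by
  have h : v k - I.wmean v = I.wmean (fun l => v k - v l) := by
    rw [wmean_sub, wmean_const I hI.wt_sum]
  rw [h]
  exact norm_wmean_le I hI fun l => hv k l

theorem norm_sub_wmean_sq_le (hI : I.Admissible) (u : Vec p) (v : Fin K → Vec p) :
    ‖u - I.wmean v‖ ^ 2 ≤ ∑ k, I.wt k * ‖u - v k‖ ^ 2 := by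
  have h : u - I.wmean v = I.wmean (fun l => u - v l) := by
    rw [wmean_sub, wmean_const I hI.wt_sum]
  have hc : ConvexOn ℝ Set.univ (fun x : Vec p => ‖x‖ ^ 2) :=
    (convexOn_norm convex_univ).pow (fun _ _ => norm_nonneg _) 2
  rw [h]
  have := hc.map_sum_le (t := Finset.univ) (w := I.wt) (p := fun l => u - v l)
    (fun k _ => hI.wt_nonneg k) hI.wt_sum (fun _ _ => Set.mem_univ _)
  simpa [Input.wmean] using this

end wmean

/-! ### The trajectory: dual averaging for the means, deviation of the clients -/

theorem add_one_mod_of_not_dvd {m n : ℕ} (h : ¬ n ∣ m + 1) : (m + 1) % n = m % n + 1 := by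
  rcases Nat.eq_zero_or_pos n with rfl | hn
  · simp
  have h1 := Nat.div_add_mod m n
  have h2 := Nat.mod_lt m hn
  rcases Nat.lt_or_ge (m % n + 1) n with h3 | h3
  · conv_lhs => rw [← h1, add_assoc, Nat.mul_add_mod, Nat.mod_eq_of_lt h3]
  · refine absurd ⟨m / n + 1, ?_⟩ h
    rw [mul_add]; omega

section trajectory

variable {I : Input p K} (O : ℕ → Fin K → Vec p → Vec p)

theorem proxArg_eq (t : ℕ) (k : Fin K) : proxArg I O t k =
    ((run I O t).grad k + alpha I.a t • usedGrad I O t k) - (I.μ / 2) • (run I O t).sum k := rfl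

theorem run_succ_of_dvd {t : ℕ} (h : I.gap ∣ t + 1) : run I O (t + 1) =
    { sol := fun _ => serverSol I O (t + 1)
      grad := fun _ => I.wmean fun k => (run I O t).grad k + alpha I.a t • usedGrad I O t k
      sum := fun _ => I.wmean (run I O t).sum + alpha I.a (t + 1) • serverSol I O (t + 1) } := by
  change step I t (O t) (run I O t) = _
  rw [step, if_pos h]
  rfl

theorem run_succ_of_not_dvd {t : ℕ} (h : ¬ I.gap ∣ t + 1) : run I O (t + 1) =
    { sol := fun k => prox I t (proxArg I O t k)
      grad := fun k => (run I O t).grad k + alpha I.a t • usedGrad I O t k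
      sum := fun k => (run I O t).sum k + alpha I.a (t + 1) • prox I t (proxArg I O t k) } := by
  change step I t (O t) (run I O t) = _
  rw [step, if_neg h]
  rfl

theorem serverSol_mem (hI : I.Admissible) (t : ℕ) : serverSol I O t ∈ I.dom := by
  cases t with
  | zero => exact hI.init_mem
  | succ t => exact hI.prox_mem t _

theorem localSol_mem (hI : I.Admissible) (t : ℕ) (k : Fin K) : localSol I O t k ∈ I.dom := by
  cases t with
  | zero => exact hI.init_mem
  | succ t =>
    by_cases h : I.gap ∣ t + 1
    · rw [localSol, run_succ_of_dvd O h]; exact serverSol_mem O hI (t + 1)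
    · rw [localSol, run_succ_of_not_dvd O h]; exact hI.prox_mem t _

theorem wmean_grad (hI : I.Admissible) (t : ℕ) : I.wmean (run I O t).grad =
    ∑ i ∈ Finset.range t, alpha I.a i • I.wmean (usedGrad I O i) := by
  induction t with
  | zero => simp [run, initState, Input.wmean]
  | succ t ih =>
    have h : I.wmean (run I O (t + 1)).grad
        = I.wmean (fun k => (run I O t).grad k + alpha I.a t • usedGrad I O t k) := by
      by_cases h : I.gap ∣ t + 1
      · rw [run_succ_of_dvd O h]; exact wmean_const I hI.wt_sum _
      · rw [run_succ_of_not_dvd O h]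
    rw [h, wmean_add, wmean_smul, Finset.sum_range_succ, ih]

theorem wmean_sum (hI : I.Admissible) (t : ℕ) : I.wmean (run I O t).sum =
    ∑ i ∈ Finset.range (t + 1), alpha I.a i • I.wmean (localSol I O i) := by
  induction t with
  | zero =>
    have h1 : I.wmean (run I O 0).sum = alpha I.a 0 • I.init := wmean_const I hI.wt_sum _
    have h2 : I.wmean (localSol I O 0) = I.init := wmean_const I hI.wt_sum _
    simp [h1, h2]
  | succ t ih =>
    rw [Finset.sum_range_succ, ← ih, ← wmean_smul, ← wmean_add]
    by_cases h : I.gap ∣ t + 1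
    · have h2 : localSol I O (t + 1) = fun _ => serverSol I O (t + 1) := by
        funext k; rw [localSol, run_succ_of_dvd O h]
      rw [run_succ_of_dvd O h, h2, wmean_add]
      simp only [wmean_add, wmean_const I hI.wt_sum]
    · have h2 : localSol I O (t + 1) = fun k => prox I t (proxArg I O t k) := by
        funext k; rw [localSol, run_succ_of_not_dvd O h]
      rw [run_succ_of_not_dvd O h, h2]

theorem wmean_proxArg (hI : I.Admissible) (t : ℕ) : I.wmean (proxArg I O t) =
    ∑ i ∈ Finset.range (t + 1), alpha I.a i •
      (I.wmean (usedGrad I O i) - (I.μ / 2) • I.wmean (localSol I O i)) := by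
  have h : proxArg I O t = fun k =>
    ((run I O t).grad k + alpha I.a t • usedGrad I O t k) - (I.μ / 2) • (run I O t).sum k := rfl
  rw [h, wmean_sub, wmean_add, wmean_smul, wmean_smul, wmean_grad O hI, wmean_sum O hI,
    ← Finset.sum_range_succ (fun i => alpha I.a i • I.wmean (usedGrad I O i)), Finset.smul_sum,
    ← Finset.sum_sub_distrib]
  refine Finset.sum_congr rfl fun i _ => ?_
  rw [smul_sub, smul_comm]

/-- The model of the objective built at step `t` from the averaged stochastic gradient. -/
noncomputable def lowerModel (I : Input p K) (O : ℕ → Fin K → Vec p → Vec p) (t : ℕ) (w : Vec p) :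
    ℝ :=
  inner ℝ (I.wmean (usedGrad I O t)) w + I.μ / 4 * ‖w - I.wmean (localSol I O t)‖ ^ 2 + I.reg w

/-- The estimate function of dual averaging. -/
noncomputable def estimateFun (I : Input p K) (O : ℕ → Fin K → Vec p → Vec p) (n : ℕ)
    (w : Vec p) : ℝ :=
  ∑ i ∈ Finset.range n, alpha I.a i * lowerModel I O i w + I.γ / 2 * ‖w - I.init‖ ^ 2

/-- Expanding the squares leaves a constant independent of `w`, so `serverSol I O (t + 1)` minimizes
the estimate function. The curvature μ/4 of the models matches the factor μ A_t/2 in front of ‖w‖²/2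
in `proxObj`. -/
theorem exists_estimateFun_eq (hI : I.Admissible) (t : ℕ) : ∃ C : ℝ, ∀ w,
    estimateFun I O (t + 1) w = proxObj I t (I.wmean (proxArg I O t)) w + C := by
  refine ⟨(∑ i ∈ Finset.range (t + 1), alpha I.a i *
    (I.μ / 4 * ‖I.wmean (localSol I O i)‖ ^ 2)) + I.γ / 2 * ‖I.init‖ ^ 2, fun w => ?_⟩
  rw [wmean_proxArg O hI]
  have e : ∀ i, alpha I.a i * lowerModel I O i w
      = inner ℝ w (alpha I.a i • (I.wmean (usedGrad I O i) - (I.μ / 2) • I.wmean (localSol I O i)))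
        + alpha I.a i * (I.μ / 4 * ‖w‖ ^ 2 + I.reg w)
        + alpha I.a i * (I.μ / 4 * ‖I.wmean (localSol I O i)‖ ^ 2) := by
    intro i
    rw [lowerModel, norm_sub_sq_real, real_inner_smul_right, inner_sub_right,
      real_inner_smul_right, real_inner_comm w]
    ring
  unfold estimateFun proxObj cumAlpha
  simp only [e, Finset.sum_add_distrib]
  rw [← Finset.sum_mul, inner_sub_right, inner_sum, norm_sub_sq_real, real_inner_smul_right]
  ring

theorem estimateFun_growth (hI : I.Admissible) (t : ℕ) {u : Vec p} (hu : u ∈ I.dom) :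
    estimateFun I O (t + 1) (serverSol I O (t + 1))
      + modulus I (t + 1) * ‖u - serverSol I O (t + 1)‖ ^ 2 ≤ estimateFun I O (t + 1) u := by
  obtain ⟨C, hC⟩ := exists_estimateFun_eq O hI t
  have := hI.prox_growth t (I.wmean (proxArg I O t)) hu
  rw [hC, hC]
  change proxObj I t _ (prox I t (I.wmean (proxArg I O t))) + C + modulus I (t + 1) *
    ‖u - prox I t (I.wmean (proxArg I O t))‖ ^ 2 ≤ _
  linarith

/-- The induction hypothesis is used at `u = serverSol I O (n + 1)`, which creates the movement
term; growth of the next estimate function then passes to arbitrary `u`. The base case is an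
equality because `modulus I 0` is γ/2. -/
theorem dual_averaging (hI : I.Admissible) (n : ℕ) : ∀ u ∈ I.dom,
    ∑ t ∈ Finset.range n, (alpha I.a t * lowerModel I O t (serverSol I O (t + 1))
        + modulus I t * ‖serverSol I O (t + 1) - serverSol I O t‖ ^ 2)
      + modulus I n * ‖u - serverSol I O n‖ ^ 2 ≤ estimateFun I O n u := by
  induction n with
  | zero => intro u _; simp [estimateFun, modulus, serverSol]
  | succ n ih =>
    intro u hu
    have h1 := ih _ (serverSol_mem O hI (n + 1))
    have h2 := estimateFun_growth O hI n hu
    have h3 : estimateFun I O (n + 1) (serverSol I O (n + 1))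
        = estimateFun I O n (serverSol I O (n + 1))
          + alpha I.a n * lowerModel I O n (serverSol I O (n + 1)) := by
      unfold estimateFun; rw [Finset.sum_range_succ]; ring
    rw [Finset.sum_range_succ]
    linarith

theorem dual_averaging_regret (hI : I.Admissible) (n : ℕ) {u : Vec p} (hu : u ∈ I.dom) :
    ∑ t ∈ Finset.range n, (alpha I.a t *
        (lowerModel I O t (serverSol I O (t + 1)) - lowerModel I O t u)
        + modulus I t * ‖serverSol I O (t + 1) - serverSol I O t‖ ^ 2)
      ≤ I.γ / 2 * ‖I.init - u‖ ^ 2 := by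
  have h1 := dual_averaging O hI n u hu
  have h2 : 0 ≤ modulus I n * ‖u - serverSol I O n‖ ^ 2 :=
    mul_nonneg (hI.modulus_pos n).le (sq_nonneg _)
  unfold estimateFun at h1
  rw [Finset.sum_add_distrib] at h1 ⊢
  simp only [mul_sub, Finset.sum_sub_distrib]
  rw [norm_sub_rev I.init u]
  linarith

/-- The window starts at the last synchronization time `t - t % I.gap`, where the deviation is zero,
and its start stays put until the next one. -/
theorem grad_sub_wmean (hI : I.Admissible) (t : ℕ) (k : Fin K) :
    (run I O t).grad k - I.wmean (run I O t).grad = ∑ i ∈ Finset.Ico (t - t % I.gap) t,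
      alpha I.a i • (usedGrad I O i k - I.wmean (usedGrad I O i)) := by
  induction t with
  | zero =>
    have : I.wmean (run I O 0).grad = 0 := wmean_const I hI.wt_sum _
    rw [this]; simp [run, initState]
  | succ t ih =>
    by_cases h : I.gap ∣ t + 1
    · rw [run_succ_of_dvd O h, Nat.mod_eq_zero_of_dvd h]
      simp [wmean_const I hI.wt_sum]
    · have hm : t + 1 - (t + 1) % I.gap = t - t % I.gap := by
        
        have h1 : (t + 1) % I.gap = t % I.gap + 1 := add_one_mod_of_not_dvd h
        omega
      rw [run_succ_of_not_dvd O h, hm, Finset.sum_Ico_succ_top (Nat.sub_le _ _), ← ih, wmean_add,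
        wmean_smul, smul_sub]
      dsimp only
      abel

/-- The window includes `t` because w̃_t already contains w_t. At a synchronization time its only
term vanishes, since all clients hold the same solution. -/
theorem sum_sub_wmean (hI : I.Admissible) (t : ℕ) (k : Fin K) :
    (run I O t).sum k - I.wmean (run I O t).sum = ∑ i ∈ Finset.Ico (t - t % I.gap) (t + 1),
      alpha I.a i • (localSol I O i k - I.wmean (localSol I O i)) := by
  induction t with
  | zero =>
    have h1 : I.wmean (run I O 0).sum = alpha I.a 0 • I.init := wmean_const I hI.wt_sum _
    have h2 : I.wmean (localSol I O 0) = I.init := wmean_const I hI.wt_sum _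
    rw [h1]; simp [run, initState, localSol, h2]
  | succ t ih =>
    by_cases h : I.gap ∣ t + 1
    · have h2 : localSol I O (t + 1) = fun _ => serverSol I O (t + 1) := by
        funext k; rw [localSol, run_succ_of_dvd O h]
      rw [run_succ_of_dvd O h, Nat.mod_eq_zero_of_dvd h]
      simp [wmean_const I hI.wt_sum, h2]
    · have hm : t + 1 - (t + 1) % I.gap = t - t % I.gap := by
        
        have h1 : (t + 1) % I.gap = t % I.gap + 1 := add_one_mod_of_not_dvd h
        omega
      have h2 : localSol I O (t + 1) = fun k => prox I t (proxArg I O t k) := by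
        funext k; rw [localSol, run_succ_of_not_dvd O h]
      rw [hm, Finset.sum_Ico_succ_top (by omega), ← ih, h2, run_succ_of_not_dvd O h, wmean_add,
        wmean_smul, smul_sub]
      dsimp only
      abel

theorem proxArg_sub_wmean (hI : I.Admissible) (t : ℕ) (k : Fin K) :
    proxArg I O t k - I.wmean (proxArg I O t) = ∑ i ∈ Finset.Ico (t - t % I.gap) (t + 1),
      alpha I.a i • ((usedGrad I O i k - I.wmean (usedGrad I O i))
        - (I.μ / 2) • (localSol I O i k - I.wmean (localSol I O i))) := by
  have h : I.wmean (proxArg I O t) = I.wmean (run I O t).grad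
      + alpha I.a t • I.wmean (usedGrad I O t) - (I.μ / 2) • I.wmean (run I O t).sum := by
    rw [← wmean_smul, ← wmean_smul, ← wmean_add, ← wmean_sub]; rfl
  have hs : ∀ i, alpha I.a i • ((usedGrad I O i k - I.wmean (usedGrad I O i))
        - (I.μ / 2) • (localSol I O i k - I.wmean (localSol I O i)))
      = alpha I.a i • (usedGrad I O i k - I.wmean (usedGrad I O i))
        - (I.μ / 2) • (alpha I.a i • (localSol I O i k - I.wmean (localSol I O i))) := by
    intro i; rw [smul_sub, smul_comm (I.μ / 2)]
  simp only [hs, Finset.sum_sub_distrib]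
  rw [← Finset.smul_sum, ← sum_sub_wmean O hI, Finset.sum_Ico_succ_top (Nat.sub_le _ _),
    ← grad_sub_wmean O hI, h, proxArg_eq, smul_sub, smul_sub]
  abel

theorem localSol_sub_serverSol_le (hI : I.Admissible) (t : ℕ) (k : Fin K) :
    2 * modulus I (t + 1) * ‖localSol I O (t + 1) k - serverSol I O (t + 1)‖
      ≤ ‖proxArg I O t k - I.wmean (proxArg I O t)‖ := by
  by_cases h : I.gap ∣ t + 1
  · rw [localSol, run_succ_of_dvd O h]; simp
  · rw [localSol, run_succ_of_not_dvd O h]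
    exact hI.norm_prox_sub_le t _ _

end trajectory

/-! ### Cubic growth of the modulus -/

section modulus

/-- Integral comparison with an endpoint correction: with s = n + a, the left side increases by s² -
1/6 at each step. -/
theorem sum_alpha_ge (a : ℝ) (n : ℕ) :
    ((n + a) ^ 3 - a ^ 3) / 3 - ((n + a) ^ 2 - a ^ 2) / 2 ≤ ∑ i ∈ Finset.range n, alpha a i := by
  induction n with
  | zero => simp
  | succ n ih =>
    rw [Finset.sum_range_succ, alpha]
    push_cast
    nlinarith

variable {I : Input p K}

theorem modulus_ge_cubic (hI : I.Admissible) (hγ : I.γ = 2 * I.μ * I.a ^ 3) (ha : 4 ≤ I.a)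
    (n : ℕ) : I.μ * ((n + I.a) ^ 3 / 12 - I.a * (n + I.a) ^ 2 / 32 + 11 / 12 * I.a ^ 3)
      ≤ modulus I n := by
  have h1 := sum_alpha_ge I.a n
  rw [modulus, hγ]
  have h2 : (n + I.a) ^ 3 / 12 - I.a * (n + I.a) ^ 2 / 32 + 11 / 12 * I.a ^ 3
      ≤ (∑ i ∈ Finset.range n, alpha I.a i) / 4 + I.a ^ 3 := by
    nlinarith [mul_nonneg (sub_nonneg.2 ha) (sq_nonneg (n + I.a)), sq_nonneg I.a]
  have h3 := mul_le_mul_of_nonneg_left h2 hI.μ_pos.le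
  linarith

theorem modulus_ge (hI : I.Admissible) (hγ : I.γ = 2 * I.μ * I.a ^ 3) (ha : 4 ≤ I.a) (n : ℕ) :
    I.μ * (n + I.a) ^ 3 / 24 ≤ modulus I n := by
  refine le_trans ?_ (modulus_ge_cubic hI hγ ha n)
  rw [mul_div_assoc]
  refine mul_le_mul_of_nonneg_left ?_ hI.μ_pos.le
  have hs : (0 : ℝ) ≤ n := n.cast_nonneg
  -- With s = n + a, the difference of the two sides is s³/24 - a s²/32 + 11a³/12, minimal over s >
  -- 0 at s = a/2. The product (s - r)²(s + r/2), which has no linear term, certifies it with r =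
  -- a/2.
  nlinarith [mul_nonneg (sq_nonneg (n + I.a - 1 / 2 * I.a)) (show 0 ≤ n + I.a + 1 / 4 * I.a by linarith),
    pow_pos hI.a_pos 3]

/-- The factor 7/8 keeps 1/8 of the movement term for the noise. The cubic to be shown nonnegative
is smallest near s = 2.54 a, whence the certificate (s - r)²(s + r/2) with r = 13a/5. -/
theorem alpha_mul_le_modulus (hI : I.Admissible) (hγ : I.γ = 2 * I.μ * I.a ^ 3) (ha : 4 ≤ I.a)
    {L : ℝ} (hL : 4 * L ≤ I.μ * I.a) (n : ℕ) : alpha I.a n * L ≤ 7 / 8 * modulus I n := by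
  have h1 := modulus_ge_cubic hI hγ ha n
  have hs : (0 : ℝ) ≤ n := n.cast_nonneg
  have h2 : I.a * (n + I.a) ^ 2 / 4 ≤
      7 / 8 * ((n + I.a) ^ 3 / 12 - I.a * (n + I.a) ^ 2 / 32 + 11 / 12 * I.a ^ 3) := by
    nlinarith [mul_nonneg (sq_nonneg (n + I.a - 13 / 5 * I.a))
      (show 0 ≤ n + I.a + 13 / 10 * I.a by linarith), pow_pos hI.a_pos 3]
  have h3 := mul_le_mul_of_nonneg_left h2 hI.μ_pos.le
  have h4 := mul_le_mul_of_nonneg_left hL (sq_nonneg (n + I.a))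
  unfold alpha
  linarith

theorem alpha_mono {a : ℝ} (ha : 0 < a) {i j : ℕ} (h : i ≤ j) : alpha a i ≤ alpha a j := by
  unfold alpha
  have : (i : ℝ) ≤ j := by exact_mod_cast h
  have hi : (0 : ℝ) ≤ i := i.cast_nonneg
  gcongr

end modulus

/-! ### Pathwise bounds on the objective gap and on the discrepancy -/

section pathwise

variable {I : Input p K} (O : ℕ → Fin K → Vec p → Vec p) (F : Fin K → Vec p → ℝ)

/-- The error of the stochastic gradient used by client `k` at step `t`. -/
noncomputable def noise (I : Input p K) (O : ℕ → Fin K → Vec p → Vec p) (F : Fin K → Vec p → ℝ)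
    (t : ℕ) (k : Fin K) : Vec p :=
  usedGrad I O t k - gradient (F k) (localSol I O t k)

/-- The weighted mean squared distance of the local solutions to the aggregated one. -/
noncomputable def discrepancy (I : Input p K) (O : ℕ → Fin K → Vec p → Vec p) (t : ℕ) : ℝ :=
  ∑ k, I.wt k * ‖localSol I O t k - serverSol I O t‖ ^ 2

variable {F} {L : ℝ}

/-- Expand around each `v k`: smoothness bounds the loss at `w` from above, strong convexity bounds
it at `u` from below. -/
theorem loss_sub_le (hI : I.Admissible)
    (hF : ∀ k, StronglyConvexSmoothOn I.μ L I.dom (F k)) {v : Fin K → Vec p}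
    (hv : ∀ k, v k ∈ I.dom) {w u : Vec p} (hw : w ∈ I.dom) (hu : u ∈ I.dom) :
    ∑ k, I.wt k * F k w - ∑ k, I.wt k * F k u ≤
      inner ℝ (I.wmean fun k => gradient (F k) (v k)) (w - u)
        + L / 2 * ∑ k, I.wt k * ‖w - v k‖ ^ 2 - I.μ / 2 * ∑ k, I.wt k * ‖u - v k‖ ^ 2 := by
  rw [Input.wmean, sum_inner, Finset.mul_sum, Finset.mul_sum, ← Finset.sum_sub_distrib,
    ← Finset.sum_add_distrib, ← Finset.sum_sub_distrib]
  refine Finset.sum_le_sum fun k _ => ?_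
  have h1 := ((hF k).2 w hw (v k) (hv k)).2
  have h2 := ((hF k).2 u hu (v k) (hv k)).1
  have h3 : inner ℝ (gradient (F k) (v k)) (w - u) =
      inner ℝ (gradient (F k) (v k)) (w - v k) - inner ℝ (gradient (F k) (v k)) (u - v k) := by
    rw [← inner_sub_right]; congr 1; abel
  have h4 : F k w - F k u ≤ inner ℝ (gradient (F k) (v k)) (w - u) + L / 2 * ‖w - v k‖ ^ 2
      - I.μ / 2 * ‖u - v k‖ ^ 2 := by rw [h3]; linarith
  have h5 := mul_le_mul_of_nonneg_left h4 (hI.wt_nonneg k)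
  rw [real_inner_smul_left]
  linarith

theorem norm_add_sq_le_two_mul (x y : Vec p) : ‖x + y‖ ^ 2 ≤ 2 * ‖x‖ ^ 2 + 2 * ‖y‖ ^ 2 := by
  have := norm_add_le x y
  nlinarith [sq_nonneg (‖x‖ - ‖y‖), norm_nonneg (x + y), norm_nonneg x, norm_nonneg y]

theorem wmean_usedGrad : I.wmean (usedGrad I O t) =
    I.wmean (fun k => gradient (F k) (localSol I O t k)) + I.wmean (noise I O F t) := by
  rw [← wmean_add]; simp [noise]

/-- Only half of the curvature μ/2 is needed at `u`, where Jensen moves the square to the mean local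
point; the model's square at the new point is nonnegative. Splitting ‖w - w_t^k‖² at w_t turns L/2
into L on both the movement and the discrepancy. -/
theorem objective_sub_le_lowerModel (hI : I.Admissible) (hL : 0 ≤ L)
    (hF : ∀ k, StronglyConvexSmoothOn I.μ L I.dom (F k)) (t : ℕ) {u : Vec p} (hu : u ∈ I.dom) :
    (∑ k, I.wt k * F k (serverSol I O (t + 1)) + I.reg (serverSol I O (t + 1)))
        - (∑ k, I.wt k * F k u + I.reg u) ≤
      lowerModel I O t (serverSol I O (t + 1)) - lowerModel I O t u
        - inner ℝ (I.wmean (noise I O F t)) (serverSol I O (t + 1) - u)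
        + L * ‖serverSol I O (t + 1) - serverSol I O t‖ ^ 2 + L * discrepancy I O t := by
  have h1 := loss_sub_le hI hF (localSol_mem O hI t) (serverSol_mem O hI (t + 1)) hu
  set w := serverSol I O (t + 1)
  have h2 := norm_sub_wmean_sq_le I hI u (localSol I O t)
  have h3 : ∑ k, I.wt k * ‖w - localSol I O t k‖ ^ 2 ≤
      2 * ‖w - serverSol I O t‖ ^ 2 + 2 * discrepancy I O t := by
    have e : 2 * ‖w - serverSol I O t‖ ^ 2 = ∑ k, I.wt k * (2 * ‖w - serverSol I O t‖ ^ 2) := by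
      rw [← Finset.sum_mul, hI.wt_sum, one_mul]
    rw [e, discrepancy, Finset.mul_sum, ← Finset.sum_add_distrib]
    refine Finset.sum_le_sum fun k _ => ?_
    have := norm_add_sq_le_two_mul (w - serverSol I O t) (serverSol I O t - localSol I O t k)
    rw [sub_add_sub_cancel, norm_sub_rev (serverSol I O t)] at this
    have := mul_le_mul_of_nonneg_left this (hI.wt_nonneg k)
    linarith
  have h4 := mul_le_mul_of_nonneg_left h3 (div_nonneg hL zero_le_two)
  have h5 := mul_le_mul_of_nonneg_left h2 hI.μ_pos.le
  have h6 : 0 ≤ ∑ k, I.wt k * ‖u - localSol I O t k‖ ^ 2 :=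
    Finset.sum_nonneg fun k _ => mul_nonneg (hI.wt_nonneg k) (sq_nonneg _)
  have h7 := mul_nonneg hI.μ_pos.le h6
  have h8 := mul_nonneg hI.μ_pos.le (sq_nonneg ‖w - I.wmean (localSol I O t)‖)
  have h9 : inner ℝ (I.wmean fun k => gradient (F k) (localSol I O t k)) (w - u) =
      inner ℝ (I.wmean (usedGrad I O t)) w - inner ℝ (I.wmean (usedGrad I O t)) u
        - inner ℝ (I.wmean (noise I O F t)) (w - u) := by
    rw [wmean_usedGrad (F := F), ← inner_sub_right, inner_add_left]; ring
  unfold lowerModel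
  linarith

theorem weighted_objective_sub_le (hI : I.Admissible) (hγ : I.γ = 2 * I.μ * I.a ^ 3)
    (ha : 4 ≤ I.a) (hL : 0 ≤ L) (hLa : 4 * L ≤ I.μ * I.a)
    (hF : ∀ k, StronglyConvexSmoothOn I.μ L I.dom (F k)) (n : ℕ) {u : Vec p} (hu : u ∈ I.dom) :
    ∑ t ∈ Finset.range n, alpha I.a t *
        ((∑ k, I.wt k * F k (serverSol I O (t + 1)) + I.reg (serverSol I O (t + 1)))
          - (∑ k, I.wt k * F k u + I.reg u)) ≤
      I.μ * I.a ^ 3 * ‖I.init - u‖ ^ 2 + ∑ t ∈ Finset.range n,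
        (alpha I.a t * inner ℝ (I.wmean (noise I O F t)) (u - serverSol I O t)
          + 48 * (t + I.a) / I.μ * ‖I.wmean (noise I O F t)‖ ^ 2
          + L * (alpha I.a t * discrepancy I O t)) := by
  have h1 := dual_averaging_regret O hI n hu
  have h2 : I.γ / 2 = I.μ * I.a ^ 3 := by rw [hγ]; ring
  rw [h2] at h1
  refine le_trans ?_ (add_le_add_left h1 _)
  rw [← Finset.sum_add_distrib]
  refine Finset.sum_le_sum fun t _ => ?_
  have h3 := mul_le_mul_of_nonneg_left (objective_sub_le_lowerModel O hI hL hF t hu)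
    (alpha_nonneg I.a t)
  refine h3.trans ?_
  set w := serverSol I O (t + 1)
  set v := serverSol I O t
  set N := I.wmean (noise I O F t)
  have hm := hI.modulus_pos t
  have hs : 0 < t + I.a := add_pos_of_nonneg_of_pos t.cast_nonneg hI.a_pos
  -- The new point depends on the noise of step t, so this part is not centred; Young's inequality
  -- charges it to the spare 1/8 of the movement term. The factor 48 is 2 · 24, with 24 from
  -- `modulus_ge`.
  have h4 : -(alpha I.a t * inner ℝ N (w - v)) ≤ 1 / 8 * modulus I t * ‖w - v‖ ^ 2
      + 48 * (t + I.a) / I.μ * ‖N‖ ^ 2 := by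
    have h5 : -(inner ℝ N (w - v)) ≤ ‖N‖ * ‖w - v‖ := by
      rw [← inner_neg_left]
      exact (real_inner_le_norm _ _).trans_eq (by rw [norm_neg])
    have h6 : alpha I.a t * (‖N‖ * ‖w - v‖) ≤ 1 / 8 * modulus I t * ‖w - v‖ ^ 2
        + 2 * alpha I.a t ^ 2 / modulus I t * ‖N‖ ^ 2 := by
      rw [← sub_nonneg]
      have : 1 / 8 * modulus I t * ‖w - v‖ ^ 2 + 2 * alpha I.a t ^ 2 / modulus I t * ‖N‖ ^ 2
          - alpha I.a t * (‖N‖ * ‖w - v‖)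
          = (modulus I t * ‖w - v‖ - 4 * alpha I.a t * ‖N‖) ^ 2 / (8 * modulus I t) := by
        field_simp; ring
      rw [this]; positivity
    have h7 : 2 * alpha I.a t ^ 2 / modulus I t ≤ 48 * (t + I.a) / I.μ := by
      have := modulus_ge hI hγ ha t
      have hμ := hI.μ_pos
      rw [div_le_div_iff₀ hm hI.μ_pos, alpha]
      nlinarith [mul_le_mul_of_nonneg_left this (by positivity : 0 ≤ 48 * (t + I.a))]
    have h8 := mul_le_mul_of_nonneg_right h7 (sq_nonneg ‖N‖)
    have h9 := mul_le_mul_of_nonneg_left h5 (alpha_nonneg I.a t)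
    linarith
  have h10 := mul_le_mul_of_nonneg_right (alpha_mul_le_modulus hI hγ ha hLa t)
    (sq_nonneg ‖w - v‖)
  have h11 : inner ℝ N (w - u) = inner ℝ N (w - v) - inner ℝ N (u - v) := by
    rw [← inner_sub_right]; congr 1; abel
  rw [h11]
  linarith

theorem card_Ico_mod_le {E : ℕ} (hE : 1 ≤ E) (t : ℕ) :
    (Finset.Ico (t - t % E) (t + 1)).card ≤ E := by
  have h1 := Nat.mod_lt t hE
  have h2 := Nat.mod_le t E
  rw [Nat.card_Ico]; omega

/-- The noise stays inside one norm, so that orthogonality can be used later; the drift is bounded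
termwise by 3G, namely 2G from the gradients and G from the μ/2 term. The constant 288 is 2 · 12²,
as twice the modulus is at least μ s³/12. -/
theorem sq_dist_localSol_serverSol_le (hI : I.Admissible) (hE : 1 ≤ I.gap)
    (hγ : I.γ = 2 * I.μ * I.a ^ 3) (ha : 4 ≤ I.a) {G : ℝ}
    (hG : ∀ k l, ∀ w ∈ I.dom, ∀ w' ∈ I.dom,
      ‖gradient (F k) w - gradient (F l) w'‖ ≤ 2 * G)
    (hμG : ∀ w ∈ I.dom, ∀ w' ∈ I.dom, I.μ * ‖w - w'‖ ≤ 2 * G) (t : ℕ) (k : Fin K) :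
    ‖localSol I O (t + 1) k - serverSol I O (t + 1)‖ ^ 2 ≤
      288 / (I.μ ^ 2 * ((t + 1 : ℕ) + I.a) ^ 6) *
        (‖∑ i ∈ Finset.Ico (t - t % I.gap) (t + 1),
            alpha I.a i • (noise I O F i k - I.wmean (noise I O F i))‖ ^ 2
          + 9 * I.gap ^ 2 * alpha I.a t ^ 2 * G ^ 2) := by
  have h1 := localSol_sub_serverSol_le O hI t k
  rw [proxArg_sub_wmean O hI] at h1
  set J := Finset.Ico (t - t % I.gap) (t + 1) with hJ
  set d := ‖localSol I O (t + 1) k - serverSol I O (t + 1)‖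
  let drift : ℕ → Vec p := fun i =>
    (gradient (F k) (localSol I O i k) - I.wmean fun l => gradient (F l) (localSol I O i l))
      - (I.μ / 2) • (localSol I O i k - I.wmean (localSol I O i))
  have hμ := hI.μ_pos
  have hG0 : 0 ≤ G := by
    have := hμG _ hI.init_mem _ hI.init_mem
    simp at this; exact this
  have hsplit : ∑ i ∈ J, alpha I.a i • ((usedGrad I O i k - I.wmean (usedGrad I O i))
        - (I.μ / 2) • (localSol I O i k - I.wmean (localSol I O i)))
      = ∑ i ∈ J, alpha I.a i • (noise I O F i k - I.wmean (noise I O F i))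
        + ∑ i ∈ J, alpha I.a i • drift i := by
    rw [← Finset.sum_add_distrib]
    refine Finset.sum_congr rfl fun i _ => ?_
    rw [← smul_add, wmean_usedGrad (F := F)]
    congr 1
    simp only [drift, noise]
    abel
  have hdrift : ∀ i, ‖drift i‖ ≤ 3 * G := by
    intro i
    have h2 := norm_sub_wmean_le I hI (v := fun l => gradient (F l) (localSol I O i l))
      (fun k l => hG k l _ (localSol_mem O hI i k) _ (localSol_mem O hI i l)) k
    have h3 := hμG _ (localSol_mem O hI i k) _ (hI.wmean_mem (localSol_mem O hI i))
    refine (norm_sub_le _ _).trans ?_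
    rw [norm_smul, Real.norm_eq_abs, abs_of_pos (half_pos hμ)]
    change I.μ * ‖localSol I O i k - I.wmean (localSol I O i)‖ ≤ _ at h3
    linarith
  have hsum : ‖∑ i ∈ J, alpha I.a i • drift i‖ ≤ I.gap * (alpha I.a t * (3 * G)) := by
    refine (norm_sum_le_of_le J (f := fun i => alpha I.a i • drift i)
      (n := fun _ => alpha I.a t * (3 * G)) ?_).trans ?_
    · intro i hi
      have hit : i ≤ t := by have := (Finset.mem_Ico.1 hi).2; omega
      rw [norm_smul, Real.norm_eq_abs, abs_of_nonneg (alpha_nonneg _ _)]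
      exact mul_le_mul (alpha_mono hI.a_pos hit) (hdrift i) (norm_nonneg _) (alpha_nonneg _ _)
    · rw [Finset.sum_const, nsmul_eq_mul]
      refine mul_le_mul_of_nonneg_right (by exact_mod_cast card_Ico_mod_le hE t) ?_
      exact mul_nonneg (alpha_nonneg _ _) (by linarith)
  have h4 := norm_add_sq_le_two_mul
    (∑ i ∈ J, alpha I.a i • (noise I O F i k - I.wmean (noise I O F i)))
    (∑ i ∈ J, alpha I.a i • drift i)
  rw [← hsplit] at h4
  have hs : 0 < ((t + 1 : ℕ) : ℝ) + I.a := add_pos_of_nonneg_of_pos (Nat.cast_nonneg _) hI.a_pos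
  have h5 : I.μ * (((t + 1 : ℕ) : ℝ) + I.a) ^ 3 / 12 * d ≤ 2 * modulus I (t + 1) * d := by
    have := modulus_ge hI hγ ha (t + 1)
    exact mul_le_mul_of_nonneg_right (by linarith) (norm_nonneg _)
  have h6 := pow_le_pow_left₀ (by positivity) (h5.trans h1) 2
  have h7 := pow_le_pow_left₀ (norm_nonneg _) hsum 2
  rw [div_mul_eq_mul_div, le_div_iff₀ (by positivity)]
  have e : (I.μ * (((t + 1 : ℕ) : ℝ) + I.a) ^ 3 / 12 * d) ^ 2
      = d ^ 2 * (I.μ ^ 2 * (((t + 1 : ℕ) : ℝ) + I.a) ^ 6) / 144 := by ring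
  rw [e] at h6
  have e2 : ((I.gap : ℝ) * (alpha I.a t * (3 * G))) ^ 2
      = 9 * I.gap ^ 2 * alpha I.a t ^ 2 * G ^ 2 := by ring
  rw [e2] at h7
  linarith

theorem discrepancy_zero : discrepancy I O 0 = 0 := by
  simp [discrepancy, localSol, serverSol, run, initState]

end pathwise

/-! ### Measurability of gradients and iterates -/

section measurability

theorem tendsto_stochGrad {S : Type*} {F : Vec p → S → ℝ} {s : S} {w : Vec p}
    (hd : DifferentiableAt ℝ (fun v => F v s) w) :
    Filter.Tendsto (fun n : ℕ => ∑ i, ((n : ℝ) *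
      (F (w + (n : ℝ)⁻¹ • EuclideanSpace.basisFun (Fin p) ℝ i) s - F w s)) •
        EuclideanSpace.basisFun (Fin p) ℝ i) Filter.atTop (nhds (stochGrad F s w)) := by
  set b := EuclideanSpace.basisFun (Fin p) ℝ
  have h1 : stochGrad F s w = ∑ i, (fderiv ℝ (fun v => F v s) w (b i)) • b i := by
    rw [← b.sum_repr' (stochGrad F s w)]
    refine Finset.sum_congr rfl fun i _ => ?_
    rw [real_inner_comm, stochGrad, gradient, InnerProductSpace.toDual_symm_apply]
  rw [h1]
  refine tendsto_finsetSum _ fun i _ => Filter.Tendsto.smul_const ?_ _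
  refine hd.hasFDerivAt.lim (b i) (c := fun n : ℕ => (n : ℝ)) ?_
  simpa using tendsto_natCast_atTop_atTop (R := ℝ)

variable {S : Type*} [MeasurableSpace S]

/-- On `W` the gradient is a pointwise limit of jointly measurable difference quotients. The
indicator discards the other points, where differentiability is not assumed. -/
theorem measurable_indicator_stochGrad {F : Vec p → S → ℝ} (hF : Measurable (Function.uncurry F))
    {W : Set (Vec p)} (hW : MeasurableSet W)
    (hd : ∀ s, ∀ w ∈ W, DifferentiableAt ℝ (fun v => F v s) w) :
    Measurable (fun z : Vec p × S => W.indicator (stochGrad F z.2) z.1) := by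
  set b := EuclideanSpace.basisFun (Fin p) ℝ
  let q : ℕ → Vec p × S → Vec p := fun n z =>
    ∑ i, ((n : ℝ) * (F (z.1 + (n : ℝ)⁻¹ • b i) z.2 - F z.1 z.2)) • b i
  have hq : ∀ n, Measurable (q n) := by
    intro n
    refine Finset.measurable_fun_sum _ fun i _ => Measurable.smul_const ?_ _
    refine Measurable.const_mul (Measurable.sub ?_ hF) _
    exact hF.comp ((measurable_fst.add_const _).prodMk measurable_snd)
  have hWS : MeasurableSet (Prod.fst ⁻¹' W : Set (Vec p × S)) := measurable_fst hW
  refine measurable_of_tendsto_metrizable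
    (f := fun n => (Prod.fst ⁻¹' W : Set (Vec p × S)).indicator (q n))
    (fun n => (hq n).indicator hWS) ?_
  rw [tendsto_pi_nhds]
  rintro ⟨w, s⟩
  by_cases hw : w ∈ W
  · have : (w, s) ∈ (Prod.fst ⁻¹' W : Set (Vec p × S)) := hw
    simp only [Set.indicator_of_mem this, Set.indicator_of_mem hw]
    exact tendsto_stochGrad (hd s w hw)
  · have : (w, s) ∉ (Prod.fst ⁻¹' W : Set (Vec p × S)) := hw
    simp only [Set.indicator_of_notMem this, Set.indicator_of_notMem hw]
    exact tendsto_const_nhds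

theorem measurable_indicator_gradient {F : Vec p → ℝ} (hF : Measurable F)
    {W : Set (Vec p)} (hW : MeasurableSet W) (hd : ∀ w ∈ W, DifferentiableAt ℝ F w) :
    Measurable (W.indicator (gradient F)) := by
  have h := measurable_indicator_stochGrad (S := Unit) (F := fun w _ => F w)
    (hF.comp measurable_fst) hW (fun _ => hd)
  exact h.comp (measurable_id.prodMk (measurable_const (a := ())))

theorem measurable_localLoss {f : Vec p → S → ℝ} (hf : Measurable (Function.uncurry f))
    (P : Measure S) [SFinite P] : Measurable (localLoss f P) :=
  (hf.stronglyMeasurable.integral_prod_right (ν := P)).measurable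

/-- The gradient oracles of the clients when client `k` draws the sample `x t k ω` at step `t`. -/
noncomputable def oracle {Ω : Type*} (f : Vec p → S → ℝ) (x : ℕ → Fin K → Ω → S) (ω : Ω) :
    ℕ → Fin K → Vec p → Vec p :=
  fun t k => stochGrad f (x t k ω)

variable {I : Input p K} {f : Vec p → S → ℝ}

theorem measurable_usedGrad_of_measurable_localSol {Ω : Type*} {mΩ : MeasurableSpace Ω}
    (hI : I.Admissible) (hf : Measurable (Function.uncurry f))
    (hd : ∀ s, ∀ w ∈ I.dom, DifferentiableAt ℝ (fun v => f v s) w) {x : ℕ → Fin K → Ω → S}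
    {t : ℕ} {k : Fin K} (hx : Measurable (x t k))
    (hs : Measurable fun ω => localSol I (oracle f x ω) t k) :
    Measurable fun ω => usedGrad I (oracle f x ω) t k := by
  have h := (measurable_indicator_stochGrad hf hI.isCompact.measurableSet hd).comp (hs.prodMk hx)
  have e : (fun ω => usedGrad I (oracle f x ω) t k) = (fun z : Vec p × S =>
      I.dom.indicator (stochGrad f z.2) z.1) ∘ fun ω => (localSol I (oracle f x ω) t k, x t k ω) := by
    funext ω
    simp only [Function.comp, Set.indicator_of_mem (localSol_mem (oracle f x ω) hI t k)]
    rfl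
  rw [e]
  exact h

/-- The σ-algebra is arbitrary and only the samples of steps before `t` must be measurable for it.
Taking the one generated by all samples but one gives independence from the omitted sample. -/
theorem measurable_run {Ω : Type*} {mΩ : MeasurableSpace Ω}
    (hI : I.Admissible) (hf : Measurable (Function.uncurry f))
    (hd : ∀ s, ∀ w ∈ I.dom, DifferentiableAt ℝ (fun v => f v s) w) {x : ℕ → Fin K → Ω → S}
    (t : ℕ) (hx : ∀ i < t, ∀ k, Measurable (x i k)) :
    (∀ k, Measurable fun ω => (run I (oracle f x ω) t).sol k) ∧
    (∀ k, Measurable fun ω => (run I (oracle f x ω) t).grad k) ∧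
    (∀ k, Measurable fun ω => (run I (oracle f x ω) t).sum k) ∧
    Measurable fun ω => serverSol I (oracle f x ω) t := by
  induction t with
  | zero => exact ⟨fun _ => measurable_const, fun _ => measurable_const, fun _ => measurable_const,
      measurable_const⟩
  | succ t ih =>
    obtain ⟨h1, h2, h3, h4⟩ := ih fun i hi k => hx i (by omega) k
    have hG : ∀ k, Measurable fun ω => usedGrad I (oracle f x ω) t k := fun k =>
      measurable_usedGrad_of_measurable_localSol hI hf hd (hx t (by omega) k) (h1 k)
    have hg : ∀ k, Measurable fun ω =>
        (run I (oracle f x ω) t).grad k + alpha I.a t • usedGrad I (oracle f x ω) t k :=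
      fun k => (h2 k).add ((hG k).fun_const_smul _)
    have hz : ∀ k, Measurable fun ω => proxArg I (oracle f x ω) t k := fun k =>
      (hg k).sub ((h3 k).fun_const_smul _)
    have hm : ∀ {v : Ω → Fin K → Vec p}, (∀ k, Measurable fun ω => v ω k) →
        Measurable fun ω => I.wmean (v ω) := fun hv =>
      Finset.measurable_fun_sum _ fun k _ => (hv k).fun_const_smul _
    have hw : Measurable fun ω => serverSol I (oracle f x ω) (t + 1) :=
      (hI.continuous_prox t).measurable.comp (hm hz)
    have hp : ∀ k, Measurable fun ω => prox I t (proxArg I (oracle f x ω) t k) := fun k =>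
      (hI.continuous_prox t).measurable.comp (hz k)
    by_cases h : I.gap ∣ t + 1
    · simp only [run_succ_of_dvd _ h]
      exact ⟨fun _ => hw, fun _ => hm hg, fun _ => (hm h3).add (hw.fun_const_smul _), hw⟩
    · simp only [run_succ_of_not_dvd _ h]
      exact ⟨hp, hg, fun k => (h3 k).add ((hp k).fun_const_smul _), hw⟩

end measurability

/-! ### Integrating out an independent sample -/

section independence

variable {Ω : Type*} [mΩ : MeasurableSpace Ω] {Pr : Measure Ω}

theorem indepFun_of_measurable_iSup {ι S β : Type*} [MeasurableSpace S] [MeasurableSpace β]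
    {X : ι → Ω → S} (hX : ∀ i, Measurable (X i)) (h : iIndepFun X Pr) (j : ι) {Y : Ω → β}
    (hY : Measurable[⨆ i ∈ ({j}ᶜ : Set ι), MeasurableSpace.comap (X i) inferInstance] Y) :
    IndepFun Y (X j) Pr := by
  have h1 := indep_iSup_of_disjoint (fun i => (hX i).comap_le) h.iIndep
    (S := ({j}ᶜ : Set ι)) (T := {j}) disjoint_compl_left
  rw [IndepFun_iff_Indep]
  refine indep_of_indep_of_le_left (indep_of_indep_of_le_right h1 ?_) hY.comap_le
  exact le_iSup₂_of_le j rfl le_rfl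

variable {S : Type*} [MeasurableSpace S] [IsProbabilityMeasure Pr] {P : Measure S}
  {C : Vec p × S → Vec p} {X : Ω → S} {u v : Ω → Vec p} {σ : ℝ}

theorem map_prodMk_eq_prod [SFinite P] (hX : Measurable X) (hXP : Measure.map X Pr = P) {β : Type*}
    [MeasurableSpace β] {Y : Ω → β} (hY : Measurable Y) (h : IndepFun Y X Pr) :
    Measure.map (fun ω => (Y ω, X ω)) Pr = (Measure.map Y Pr).prod P := by
  rw [(indepFun_iff_map_prod_eq_prod_map_map hY.aemeasurable hX.aemeasurable).1 h, hXP]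

variable [IsProbabilityMeasure P]

/-- The joint law is a product, so the sample is integrated first, with the value of `u` frozen. -/
theorem integral_sq_norm_le_of_indepFun (hX : Measurable X) (hXP : Measure.map X Pr = P)
    (hu : Measurable u) (h : IndepFun u X Pr) (hC : Measurable C)
    (hC2 : ∀ w, Integrable (fun s => ‖C (w, s)‖ ^ 2) P)
    (hCσ : ∀ w, ∫ s, ‖C (w, s)‖ ^ 2 ∂P ≤ σ ^ 2) :
    Integrable (fun ω => ‖C (u ω, X ω)‖ ^ 2) Pr ∧ ∫ ω, ‖C (u ω, X ω)‖ ^ 2 ∂Pr ≤ σ ^ 2 := by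
  have hmap := map_prodMk_eq_prod hX hXP hu h
  have : IsProbabilityMeasure (Measure.map u Pr) := Measure.isProbabilityMeasure_map hu.aemeasurable
  have hm : Measurable fun z : Vec p × S => ‖C z‖ ^ 2 := hC.norm.pow_const 2
  have hint : Integrable (fun z : Vec p × S => ‖C z‖ ^ 2) ((Measure.map u Pr).prod P) := by
    rw [integrable_prod_iff hm.aestronglyMeasurable]
    refine ⟨Filter.Eventually.of_forall hC2, ?_⟩
    refine Integrable.mono' (integrable_const (σ ^ 2))
      (hm.norm.stronglyMeasurable.integral_prod_right' (ν := P)).aestronglyMeasurable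
      (Filter.Eventually.of_forall fun w => ?_)
    have e : ∀ s, ‖‖C (w, s)‖ ^ 2‖ = ‖C (w, s)‖ ^ 2 := fun s => by simp
    simp only [e]
    rw [Real.norm_of_nonneg (integral_nonneg fun s => sq_nonneg _)]
    exact hCσ w
  have hint' := hint
  rw [← hmap] at hint
  refine ⟨hint.comp_measurable (hu.prodMk hX), ?_⟩
  rw [← integral_map (hu.prodMk hX).aemeasurable (f := fun z => ‖C z‖ ^ 2)
    hm.aestronglyMeasurable, hmap, integral_prod _ hint']
  calc ∫ w, ∫ s, ‖C (w, s)‖ ^ 2 ∂P ∂(Measure.map u Pr) ≤ ∫ _, σ ^ 2 ∂(Measure.map u Pr) :=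
        integral_mono hint'.integral_prod_left (integrable_const _) hCσ
    _ = σ ^ 2 := by simp

theorem integral_inner_eq_zero_of_indepFun (hX : Measurable X) (hXP : Measure.map X Pr = P)
    (hu : Measurable u) (hv : Measurable v) (h : IndepFun (fun ω => (u ω, v ω)) X Pr)
    (hC : Measurable C) (hC1 : ∀ w, Integrable (fun s => C (w, s)) P)
    (hC0 : ∀ w, ∫ s, C (w, s) ∂P = 0)
    (hint : Integrable (fun ω => inner ℝ (C (u ω, X ω)) (v ω)) Pr) :
    ∫ ω, inner ℝ (C (u ω, X ω)) (v ω) ∂Pr = 0 := by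
  have hmap := map_prodMk_eq_prod hX hXP (hu.prodMk hv) h
  have : IsProbabilityMeasure (Measure.map (fun ω => (u ω, v ω)) Pr) :=
    Measure.isProbabilityMeasure_map (hu.prodMk hv).aemeasurable
  have hm : Measurable fun z : (Vec p × Vec p) × S => inner ℝ (C (z.1.1, z.2)) z.1.2 :=
    (hC.comp ((measurable_fst.comp measurable_fst).prodMk measurable_snd)).inner
      (measurable_snd.comp measurable_fst)
  have hmeas := (hu.prodMk hv).prodMk hX
  have hint' : Integrable (fun z : (Vec p × Vec p) × S => inner ℝ (C (z.1.1, z.2)) z.1.2)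
      ((Measure.map (fun ω => (u ω, v ω)) Pr).prod P) := by
    rw [← hmap, integrable_map_measure hm.aestronglyMeasurable hmeas.aemeasurable]
    exact hint
  have e := integral_map (μ := Pr) hmeas.aemeasurable
    (f := fun z : (Vec p × Vec p) × S => inner ℝ (C (z.1.1, z.2)) z.1.2) hm.aestronglyMeasurable
  rw [← e, hmap, integral_prod _ hint']
  refine integral_eq_zero_of_ae (Filter.Eventually.of_forall fun y => ?_)
  have : ∫ s, inner ℝ (C (y.1, s)) y.2 ∂P = inner ℝ y.2 (∫ s, C (y.1, s) ∂P) := by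
    rw [← integral_inner (hC1 y.1)]
    simp only [real_inner_comm]
  simp [this, hC0]

end independence

/-! ### Pythagoras for orthogonal random vectors -/

section orthogonality

variable {Ω ι : Type*} [MeasurableSpace Ω] {Pr : Measure Ω}

theorem integrable_inner_of_sq {X Y : Ω → Vec p} (hX : Measurable X) (hY : Measurable Y)
    (hX2 : Integrable (fun ω => ‖X ω‖ ^ 2) Pr) (hY2 : Integrable (fun ω => ‖Y ω‖ ^ 2) Pr) :
    Integrable (fun ω => inner ℝ (X ω) (Y ω)) Pr := by
  refine Integrable.mono' (hX2.add hY2) (hX.inner hY).aestronglyMeasurable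
    (Filter.Eventually.of_forall fun ω => ?_)
  have := norm_inner_le_norm (𝕜 := ℝ) (X ω) (Y ω)
  simp only [Pi.add_apply]
  nlinarith [sq_nonneg (‖X ω‖ - ‖Y ω‖), sq_nonneg ‖X ω‖, sq_nonneg ‖Y ω‖]

theorem integral_sq_norm_sum {X : ι → Ω → Vec p} (hX : ∀ i, Measurable (X i))
    (hX2 : ∀ i, Integrable (fun ω => ‖X i ω‖ ^ 2) Pr)
    (h0 : ∀ i j, i ≠ j → ∫ ω, inner ℝ (X i ω) (X j ω) ∂Pr = 0) (s : Finset ι) (c : ι → ℝ) :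
    Integrable (fun ω => ‖∑ i ∈ s, c i • X i ω‖ ^ 2) Pr ∧
    ∫ ω, ‖∑ i ∈ s, c i • X i ω‖ ^ 2 ∂Pr = ∑ i ∈ s, c i ^ 2 * ∫ ω, ‖X i ω‖ ^ 2 ∂Pr := by
  classical
  have e : ∀ ω, ‖∑ i ∈ s, c i • X i ω‖ ^ 2
      = ∑ i ∈ s, ∑ j ∈ s, c i * c j * inner ℝ (X i ω) (X j ω) := by
    intro ω
    rw [← real_inner_self_eq_norm_sq, sum_inner]
    refine Finset.sum_congr rfl fun i _ => ?_
    rw [inner_sum]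
    refine Finset.sum_congr rfl fun j _ => ?_
    rw [real_inner_smul_left, real_inner_smul_right]; ring
  have hi : ∀ i j, Integrable (fun ω => c i * c j * inner ℝ (X i ω) (X j ω)) Pr := fun i j =>
    (integrable_inner_of_sq (hX i) (hX j) (hX2 i) (hX2 j)).const_mul _
  simp only [e]
  refine ⟨integrable_finsetSum _ fun i _ => integrable_finsetSum _ fun j _ => hi i j, ?_⟩
  rw [integral_finsetSum _ fun i _ => integrable_finsetSum _ fun j _ => hi i j]
  refine Finset.sum_congr rfl fun i his => ?_
  rw [integral_finsetSum _ fun j _ => hi i j, Finset.sum_eq_single i]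
  · rw [integral_const_mul]
    simp only [real_inner_self_eq_norm_sq]
    ring
  · intro j _ hj
    rw [integral_const_mul, h0 i j hj.symm, mul_zero]
  · exact fun h => absurd his h

end orthogonality

/-! ### Moments and orthogonality of the gradient noise -/

section sampling

variable {S : Type*} [MeasurableSpace S]

/-- The centred stochastic gradient of a client with data law `P`, extended by `0` outside `W`. -/
noncomputable def centredGrad (f : Vec p → S → ℝ) (P : Measure S) (W : Set (Vec p))
    (z : Vec p × S) : Vec p :=
  W.indicator (stochGrad f z.2) z.1 - W.indicator (gradient (localLoss f P)) z.1

section centredGrad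

variable {f : Vec p → S → ℝ} {P : Measure S} {W : Set (Vec p)} {σ : ℝ}

theorem centredGrad_of_mem {w : Vec p} (hw : w ∈ W) (s : S) :
    centredGrad f P W (w, s) = stochGrad f s w - gradient (localLoss f P) w := by
  simp [centredGrad, hw]

theorem centredGrad_of_notMem {w : Vec p} (hw : w ∉ W) (s : S) :
    centredGrad f P W (w, s) = 0 := by
  simp [centredGrad, hw]

theorem integral_sq_centredGrad_le (h : UnbiasedBoundedVariance f P W σ) (w : Vec p) :
    ∫ s, ‖centredGrad f P W (w, s)‖ ^ 2 ∂P ≤ σ ^ 2 := by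
  by_cases hw : w ∈ W
  · simp only [centredGrad_of_mem hw]
    exact (h w hw).2.2.2
  · simp [centredGrad_of_notMem hw, sq_nonneg]

variable [IsProbabilityMeasure P]

theorem measurable_centredGrad (hf : Measurable (Function.uncurry f)) (hW : MeasurableSet W)
    (hd : ∀ s, ∀ w ∈ W, DifferentiableAt ℝ (fun v => f v s) w)
    (hdL : ∀ w ∈ W, DifferentiableAt ℝ (localLoss f P) w) :
    Measurable (centredGrad f P W) :=
  (measurable_indicator_stochGrad hf hW hd).sub
    ((measurable_indicator_gradient (measurable_localLoss hf P) hW hdL).comp measurable_fst)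

theorem integrable_centredGrad (h : UnbiasedBoundedVariance f P W σ) (w : Vec p) :
    Integrable (fun s => centredGrad f P W (w, s)) P := by
  by_cases hw : w ∈ W
  · simp only [centredGrad_of_mem hw]
    exact (h w hw).1.sub (integrable_const _)
  · simp [centredGrad_of_notMem hw]

theorem integral_centredGrad (h : UnbiasedBoundedVariance f P W σ) (w : Vec p) :
    ∫ s, centredGrad f P W (w, s) ∂P = 0 := by
  by_cases hw : w ∈ W
  · simp only [centredGrad_of_mem hw]
    rw [integral_sub (h w hw).1 (integrable_const _), (h w hw).2.1]
    simp
  · simp [centredGrad_of_notMem hw]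

theorem integrable_sq_centredGrad (h : UnbiasedBoundedVariance f P W σ) (w : Vec p) :
    Integrable (fun s => ‖centredGrad f P W (w, s)‖ ^ 2) P := by
  by_cases hw : w ∈ W
  · simp only [centredGrad_of_mem hw]
    exact (h w hw).2.2.1
  · simp [centredGrad_of_notMem hw]

end centredGrad

/-- The stochastic assumptions: admissible inputs, a regular loss with unbiased stochastic
gradients, and independent samples. -/
structure SamplingModel {Ω : Type*} {_ : MeasurableSpace Ω} (I : Input p K) (f : Vec p → S → ℝ)
    (P : Fin K → Measure S) (Pr : Measure Ω) (x : ℕ → Fin K → Ω → S) (σ : ℝ) : Prop where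
  admissible : I.Admissible
  measurable_loss : Measurable (Function.uncurry f)
  differentiableAt_loss : ∀ s, ∀ w ∈ I.dom, DifferentiableAt ℝ (fun v => f v s) w
  differentiableAt_localLoss : ∀ k, ∀ w ∈ I.dom, DifferentiableAt ℝ (localLoss f (P k)) w
  unbiased : ∀ k, UnbiasedBoundedVariance f (P k) I.dom σ
  measurable_sample : ∀ t k, Measurable (x t k)
  map_sample : ∀ t k, Measure.map (x t k) Pr = P k
  indep : iIndepFun (fun i : ℕ × Fin K => x i.1 i.2) Pr

section noise

variable {Ω : Type*} {I : Input p K} {f : Vec p → S → ℝ} {P : Fin K → Measure S}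
  {x : ℕ → Fin K → Ω → S} {σ : ℝ}

/-- The error of the stochastic gradient of client `k` at step `t`, as a random variable. -/
noncomputable def sampleNoise (I : Input p K) (f : Vec p → S → ℝ) (P : Fin K → Measure S)
    (x : ℕ → Fin K → Ω → S) (t : ℕ) (k : Fin K) (ω : Ω) : Vec p :=
  noise I (oracle f x ω) (fun k => localLoss f (P k)) t k

theorem sampleNoise_eq (hI : I.Admissible) (t : ℕ) (k : Fin K) (ω : Ω) :
    sampleNoise I f P x t k ω
      = centredGrad f (P k) I.dom (localSol I (oracle f x ω) t k, x t k ω) := by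
  rw [centredGrad_of_mem (localSol_mem (oracle f x ω) hI t k)]
  rfl

variable {mΩ : MeasurableSpace Ω} {Pr : Measure Ω}

theorem SamplingModel.measurable_localSol (h : SamplingModel I f P Pr x σ) (t : ℕ) (k : Fin K) :
    Measurable fun ω => localSol I (oracle f x ω) t k :=
  (measurable_run h.admissible h.measurable_loss h.differentiableAt_loss t
    fun i _ l => h.measurable_sample i l).1 k

theorem SamplingModel.measurable_serverSol (h : SamplingModel I f P Pr x σ) (t : ℕ) :
    Measurable fun ω => serverSol I (oracle f x ω) t :=
  (measurable_run h.admissible h.measurable_loss h.differentiableAt_loss t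
    fun i _ l => h.measurable_sample i l).2.2.2

/-- A random vector that does not depend on the sample `x t k` is, jointly with the local solution
of client `k` at step `t`, independent of this sample. -/
theorem SamplingModel.indepFun_sample (h : SamplingModel I f P Pr x σ)
    (t : ℕ) (k : Fin K) {v : Ω → Vec p}
    (hv : Measurable[⨆ i ∈ ({(t, k)}ᶜ : Set (ℕ × Fin K)),
      MeasurableSpace.comap (x i.1 i.2) inferInstance] v) :
    IndepFun (fun ω => (localSol I (oracle f x ω) t k, v ω)) (x t k) Pr := by
  refine indepFun_of_measurable_iSup (X := fun i : ℕ × Fin K => x i.1 i.2)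
    (fun i => h.measurable_sample _ _) h.indep (t, k) (Measurable.prodMk ?_ hv)
  refine (measurable_run h.admissible h.measurable_loss h.differentiableAt_loss t
    fun i hi l => ?_).1 k
  refine Measurable.of_comap_le ?_
  exact le_iSup₂_of_le (f := fun (i : ℕ × Fin K) (_ : i ∈ ({(t, k)}ᶜ : Set (ℕ × Fin K))) =>
    MeasurableSpace.comap (x i.1 i.2) inferInstance) (i, l) (by simp; omega) le_rfl

variable [∀ k, IsProbabilityMeasure (P k)]

theorem SamplingModel.measurable_sampleNoise_of
    (h : SamplingModel I f P Pr x σ) {m : MeasurableSpace Ω} {t : ℕ} {k : Fin K}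
    (hx : ∀ i < t, ∀ l, Measurable[m] (x i l)) (hxt : Measurable[m] (x t k)) :
    Measurable[m] (sampleNoise I f P x t k) := by
  have hs := (measurable_run (mΩ := m) h.admissible h.measurable_loss h.differentiableAt_loss t
    hx).1 k
  have h1 := (measurable_centredGrad h.measurable_loss h.admissible.isCompact.measurableSet
    h.differentiableAt_loss (h.differentiableAt_localLoss k)).comp (hs.prodMk hxt)
  have e : sampleNoise I f P x t k = centredGrad f (P k) I.dom ∘ fun ω =>
      ((run I (oracle f x ω) t).sol k, x t k ω) := funext fun ω =>
    sampleNoise_eq h.admissible t k ω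
  rw [e]
  exact h1

theorem SamplingModel.measurable_sampleNoise (h : SamplingModel I f P Pr x σ) (t : ℕ) (k : Fin K) :
    Measurable (sampleNoise I f P x t k) :=
  h.measurable_sampleNoise_of (fun i _ l => h.measurable_sample i l) (h.measurable_sample t k)

variable [IsProbabilityMeasure Pr]

theorem SamplingModel.sq_sampleNoise (h : SamplingModel I f P Pr x σ) (t : ℕ) (k : Fin K) :
    Integrable (fun ω => ‖sampleNoise I f P x t k ω‖ ^ 2) Pr ∧
      ∫ ω, ‖sampleNoise I f P x t k ω‖ ^ 2 ∂Pr ≤ σ ^ 2 := by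
  simp only [sampleNoise_eq h.admissible]
  have hi := h.indepFun_sample t k (v := fun _ => 0) measurable_const
  exact integral_sq_norm_le_of_indepFun (h.measurable_sample t k) (h.map_sample t k)
    (h.measurable_localSol t k) (hi.comp measurable_fst measurable_id)
    (measurable_centredGrad h.measurable_loss h.admissible.isCompact.measurableSet
      h.differentiableAt_loss (h.differentiableAt_localLoss k))
    (integrable_sq_centredGrad (h.unbiased k)) (integral_sq_centredGrad_le (h.unbiased k))

theorem SamplingModel.integral_inner_sampleNoise (h : SamplingModel I f P Pr x σ)
    (t : ℕ) (k : Fin K) {v : Ω → Vec p}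
    (hv : Measurable v) (hv2 : Integrable (fun ω => ‖v ω‖ ^ 2) Pr)
    (hvm : Measurable[⨆ i ∈ ({(t, k)}ᶜ : Set (ℕ × Fin K)),
      MeasurableSpace.comap (x i.1 i.2) inferInstance] v) :
    ∫ ω, inner ℝ (sampleNoise I f P x t k ω) (v ω) ∂Pr = 0 := by
  have hint := integrable_inner_of_sq (h.measurable_sampleNoise t k) hv (h.sq_sampleNoise t k).1 hv2
  simp only [sampleNoise_eq h.admissible] at hint ⊢
  exact integral_inner_eq_zero_of_indepFun (h.measurable_sample t k) (h.map_sample t k)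
    (h.measurable_localSol t k) hv (h.indepFun_sample t k hvm)
    (measurable_centredGrad h.measurable_loss h.admissible.isCompact.measurableSet
      h.differentiableAt_loss (h.differentiableAt_localLoss k))
    (integrable_centredGrad (h.unbiased k)) (integral_centredGrad (h.unbiased k)) hint

/-- The noise of index `i` involves earlier samples and its own, never the sample of index `j`; this
also covers two clients at the same step. -/
theorem SamplingModel.integral_inner_sampleNoise_of_le (h : SamplingModel I f P Pr x σ)
    {i j : ℕ × Fin K} (hij : i ≠ j)
    (hle : i.1 ≤ j.1) :
    ∫ ω, inner ℝ (sampleNoise I f P x j.1 j.2 ω) (sampleNoise I f P x i.1 i.2 ω) ∂Pr = 0 := by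
  refine h.integral_inner_sampleNoise j.1 j.2 (h.measurable_sampleNoise _ _)
    (h.sq_sampleNoise _ _).1 ?_
  have key : ∀ i : ℕ × Fin K, i ≠ j → Measurable[⨆ i ∈ ({(j.1, j.2)}ᶜ : Set (ℕ × Fin K)),
      MeasurableSpace.comap (x i.1 i.2) inferInstance] (x i.1 i.2) := fun i hi =>
    Measurable.of_comap_le
      (le_iSup₂_of_le (f := fun (i : ℕ × Fin K) (_ : i ∈ ({(j.1, j.2)}ᶜ : Set (ℕ × Fin K))) =>
        MeasurableSpace.comap (x i.1 i.2) inferInstance) i (by simpa using hi) le_rfl)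
  refine h.measurable_sampleNoise_of (fun n hn l => key (n, l) ?_) (key i hij)
  intro hc
  have : n = j.1 := congrArg Prod.fst hc
  omega

theorem SamplingModel.sampleNoise_orthogonal (h : SamplingModel I f P Pr x σ)
    (i j : ℕ × Fin K) (hij : i ≠ j) :
    ∫ ω, inner ℝ (sampleNoise I f P x i.1 i.2 ω) (sampleNoise I f P x j.1 j.2 ω) ∂Pr = 0 := by
  rcases le_total i.1 j.1 with hle | hle
  · have := h.integral_inner_sampleNoise_of_le hij hle
    simpa only [real_inner_comm] using this
  · exact h.integral_inner_sampleNoise_of_le hij.symm hle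

theorem SamplingModel.sq_sum_sampleNoise (h : SamplingModel I f P Pr x σ)
    (s : Finset (ℕ × Fin K)) (c : ℕ × Fin K → ℝ) :
    Integrable (fun ω => ‖∑ i ∈ s, c i • sampleNoise I f P x i.1 i.2 ω‖ ^ 2) Pr ∧
      ∫ ω, ‖∑ i ∈ s, c i • sampleNoise I f P x i.1 i.2 ω‖ ^ 2 ∂Pr
        ≤ (∑ i ∈ s, c i ^ 2) * σ ^ 2 := by
  have h1 := integral_sq_norm_sum (X := fun i : ℕ × Fin K => sampleNoise I f P x i.1 i.2)
    (fun i => h.measurable_sampleNoise i.1 i.2) (fun i => (h.sq_sampleNoise i.1 i.2).1)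
    h.sampleNoise_orthogonal s c
  refine ⟨h1.1, h1.2.trans_le ?_⟩
  rw [Finset.sum_mul]
  exact Finset.sum_le_sum fun i _ =>
    mul_le_mul_of_nonneg_left (h.sq_sampleNoise i.1 i.2).2 (sq_nonneg _)

theorem SamplingModel.sq_sum_wmean_sampleNoise (h : SamplingModel I f P Pr x σ)
    (J : Finset ℕ) (c : ℕ → ℝ) :
    Integrable (fun ω => ‖∑ i ∈ J, c i • I.wmean (fun k => sampleNoise I f P x i k ω)‖ ^ 2) Pr ∧
      ∫ ω, ‖∑ i ∈ J, c i • I.wmean (fun k => sampleNoise I f P x i k ω)‖ ^ 2 ∂Pr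
        ≤ (∑ i ∈ J, c i ^ 2) * (∑ k, I.wt k ^ 2) * σ ^ 2 := by
  have h1 := h.sq_sum_sampleNoise (J ×ˢ Finset.univ) fun i => c i.1 * I.wt i.2
  simp only [Finset.sum_product, mul_smul, ← Finset.smul_sum, mul_pow] at h1
  rw [← Finset.sum_mul_sum] at h1
  exact h1

theorem SamplingModel.sq_wmean_sampleNoise (h : SamplingModel I f P Pr x σ) (t : ℕ) :
    Integrable (fun ω => ‖I.wmean (fun k => sampleNoise I f P x t k ω)‖ ^ 2) Pr ∧
      ∫ ω, ‖I.wmean (fun k => sampleNoise I f P x t k ω)‖ ^ 2 ∂Pr ≤ ∑ k, I.wt k ^ 2 * σ ^ 2 := by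
  have h1 := h.sq_sum_wmean_sampleNoise {t} fun _ => 1
  simpa [Finset.sum_mul] using h1

/-- Orthogonality gives ∑ c_i² instead of (∑ c_i)², hence a variance linear in E. The constant is 2
+ 2 ∑ π_k² ≤ 4. -/
theorem SamplingModel.sq_sum_sampleNoise_sub_wmean (h : SamplingModel I f P Pr x σ)
    (J : Finset ℕ) (c : ℕ → ℝ) (k : Fin K) :
    Integrable (fun ω => ‖∑ i ∈ J, c i • (sampleNoise I f P x i k ω
        - I.wmean (fun l => sampleNoise I f P x i l ω))‖ ^ 2) Pr ∧
      ∫ ω, ‖∑ i ∈ J, c i • (sampleNoise I f P x i k ω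
        - I.wmean (fun l => sampleNoise I f P x i l ω))‖ ^ 2 ∂Pr
        ≤ 4 * (∑ i ∈ J, c i ^ 2) * σ ^ 2 := by
  have hA := h.sq_sum_sampleNoise (J ×ˢ {k}) fun i => c i.1
  simp only [Finset.sum_product, Finset.sum_singleton] at hA
  have hB := h.sq_sum_wmean_sampleNoise J c
  have hw : ∑ k, I.wt k ^ 2 ≤ 1 := by
    rw [← h.admissible.wt_sum]
    refine Finset.sum_le_sum fun k _ => ?_
    have h0 := h.admissible.wt_nonneg k
    have h1 : I.wt k ≤ 1 := by
      rw [← h.admissible.wt_sum]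
      exact Finset.single_le_sum (fun l _ => h.admissible.wt_nonneg l) (Finset.mem_univ k)
    nlinarith
  have hle : ∀ ω, ‖∑ i ∈ J, c i • (sampleNoise I f P x i k ω
        - I.wmean (fun l => sampleNoise I f P x i l ω))‖ ^ 2 ≤
      2 * ‖∑ i ∈ J, c i • sampleNoise I f P x i k ω‖ ^ 2
        + 2 * ‖∑ i ∈ J, c i • I.wmean (fun k => sampleNoise I f P x i k ω)‖ ^ 2 := by
    intro ω
    have := norm_add_sq_le_two_mul (∑ i ∈ J, c i • sampleNoise I f P x i k ω)
      (-∑ i ∈ J, c i • I.wmean (fun k => sampleNoise I f P x i k ω))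
    rw [norm_neg, ← sub_eq_add_neg, ← Finset.sum_sub_distrib] at this
    simpa only [smul_sub] using this
  have hint := (hA.1.const_mul 2).add (hB.1.const_mul 2)
  have hm : Measurable fun ω => ‖∑ i ∈ J, c i • (sampleNoise I f P x i k ω
        - I.wmean (fun l => sampleNoise I f P x i l ω))‖ ^ 2 := by
    refine Measurable.pow_const (Measurable.norm ?_) 2
    refine Finset.measurable_fun_sum _ fun i _ => Measurable.fun_const_smul ?_ _
    refine (h.measurable_sampleNoise i k).sub ?_
    exact Finset.measurable_fun_sum _ fun l _ => (h.measurable_sampleNoise i l).fun_const_smul _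
  have hint2 : Integrable (fun ω => ‖∑ i ∈ J, c i • (sampleNoise I f P x i k ω
        - I.wmean (fun l => sampleNoise I f P x i l ω))‖ ^ 2) Pr := by
    refine hint.mono' hm.aestronglyMeasurable (Filter.Eventually.of_forall fun ω => ?_)
    rw [Real.norm_of_nonneg (sq_nonneg _)]
    exact hle ω
  refine ⟨hint2, (integral_mono hint2 hint hle).trans ?_⟩
  rw [integral_add' (hA.1.const_mul 2) (hB.1.const_mul 2), integral_const_mul, integral_const_mul]
  have h3 : (∑ i ∈ J, c i ^ 2) * (∑ k, I.wt k ^ 2) * σ ^ 2 ≤ (∑ i ∈ J, c i ^ 2) * 1 * σ ^ 2 := by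
    have : 0 ≤ ∑ i ∈ J, c i ^ 2 := Finset.sum_nonneg fun i _ => sq_nonneg _
    gcongr
  linarith [hA.2, hB.2]

end noise

end sampling

/-! ### Convexity and gradient bounds for the losses -/

section convexity

variable {W : Set (Vec p)} {F : Vec p → ℝ} {μ L : ℝ}

theorem StronglyConvexSmoothOn.convexOn (hF : StronglyConvexSmoothOn μ L W F) (hμ : 0 ≤ μ)
    (hW : Convex ℝ W) : ConvexOn ℝ W F := by
  refine ⟨hW, fun x hx y hy a b ha hb hab => ?_⟩
  have hm := hW hx hy ha hb hab
  set m := a • x + b • y with hm_def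
  have h1 := (hF.2 x hx m hm).1
  have h2 := (hF.2 y hy m hm).1
  have h3 : a * inner ℝ (gradient F m) (x - m) + b * inner ℝ (gradient F m) (y - m) = 0 := by
    rw [← real_inner_smul_right, ← real_inner_smul_right, ← inner_add_right]
    have : a • (x - m) + b • (y - m) = 0 := by
      have : a • (x - m) + b • (y - m) = m - (a + b) • m := by
        rw [smul_sub, smul_sub, add_smul, hm_def]; abel
      rw [this, hab, one_smul, sub_self]
    rw [this, inner_zero_right]
  have h4 : 0 ≤ F x - F m - inner ℝ (gradient F m) (x - m) := le_trans (by positivity) h1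
  have h5 : 0 ≤ F y - F m - inner ℝ (gradient F m) (y - m) := le_trans (by positivity) h2
  have h6 : F m = a * F m + b * F m := by rw [← add_mul, hab, one_mul]
  simp only [smul_eq_mul]
  nlinarith [mul_nonneg ha h4, mul_nonneg hb h5]

theorem StronglyConvexSmoothOn.inner_gradient_sub_ge (hF : StronglyConvexSmoothOn μ L W F)
    {w w' : Vec p} (hw : w ∈ W) (hw' : w' ∈ W) :
    μ * ‖w - w'‖ ^ 2 ≤ inner ℝ (gradient F w - gradient F w') (w - w') := by
  have h1 := (hF.2 w hw w' hw').1
  have h2 := (hF.2 w' hw' w hw).1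
  rw [← neg_sub w w', norm_neg, inner_neg_right] at h2
  rw [inner_sub_left]
  linarith

end convexity

section globalLoss

variable {S : Type*} [MeasurableSpace S] {f : Vec p → S → ℝ} {P : Fin K → Measure S}
  {wt : Fin K → ℝ} {W : Set (Vec p)} {μ L : ℝ}

theorem gradient_globalLoss {w : Vec p}
    (hd : ∀ k, DifferentiableAt ℝ (localLoss f (P k)) w) :
    gradient (globalLoss f P wt) w = ∑ k, wt k • gradient (localLoss f (P k)) w := by
  have h : HasFDerivAt (globalLoss f P wt) (∑ k, wt k • fderiv ℝ (localLoss f (P k)) w) w :=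
    HasFDerivAt.fun_sum fun k _ => (hd k).hasFDerivAt.const_mul (wt k)
  rw [gradient, h.fderiv, map_sum]
  refine Finset.sum_congr rfl fun k _ => ?_
  rw [map_smulₛₗ]
  rfl

/-- Strong monotonicity and Cauchy–Schwarz. With the Lipschitz bound it gives μ‖w - w'‖ ≤ 2Λρ, so
the μ/2 part of the drift is absorbed in H + Λρ. -/
theorem mul_norm_sub_le_norm_gradient_globalLoss_sub (hwt : ∀ k, 0 ≤ wt k) (hwt1 : ∑ k, wt k = 1)
    (hF : ∀ k, StronglyConvexSmoothOn μ L W (localLoss f (P k))) {w w' : Vec p} (hw : w ∈ W)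
    (hw' : w' ∈ W) :
    μ * ‖w - w'‖ ≤ ‖gradient (globalLoss f P wt) w - gradient (globalLoss f P wt) w'‖ := by
  have h1 : μ * ‖w - w'‖ ^ 2 ≤ inner ℝ
      (gradient (globalLoss f P wt) w - gradient (globalLoss f P wt) w') (w - w') := by
    rw [gradient_globalLoss fun k => (hF k).1 w hw, gradient_globalLoss fun k => (hF k).1 w' hw',
      ← Finset.sum_sub_distrib, sum_inner]
    calc μ * ‖w - w'‖ ^ 2 = ∑ k, wt k * (μ * ‖w - w'‖ ^ 2) := by
          rw [← Finset.sum_mul, hwt1, one_mul]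
      _ ≤ _ := by
          refine Finset.sum_le_sum fun k _ => ?_
          rw [← smul_sub, real_inner_smul_left]
          exact mul_le_mul_of_nonneg_left ((hF k).inner_gradient_sub_ge hw hw') (hwt k)
  have h2 := h1.trans (real_inner_le_norm _ _)
  rcases (norm_nonneg (w - w')).eq_or_lt with h0 | h0
  · rw [← h0]; simp
  · exact le_of_mul_le_mul_right (by rw [mul_assoc, ← sq]; exact h2) h0

theorem norm_gradient_localLoss_sub_le {Λ H ρ : ℝ} (hΛ : 0 < Λ)
    (hLip : ∀ w ∈ W, ∀ w' ∈ W,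
      ‖gradient (globalLoss f P wt) w - gradient (globalLoss f P wt) w'‖ ≤ Λ * ‖w - w'‖)
    (hH : ∀ k, ∀ w ∈ W,
      ‖gradient (globalLoss f P wt) w - gradient (localLoss f (P k)) w‖ ≤ H)
    (hρ : ∀ w ∈ W, ∀ w' ∈ W, ‖w - w'‖ ≤ 2 * ρ) (k l : Fin K) {w w' : Vec p}
    (hw : w ∈ W) (hw' : w' ∈ W) :
    ‖gradient (localLoss f (P k)) w - gradient (localLoss f (P l)) w'‖ ≤ 2 * (H + Λ * ρ) := by
  set g := gradient (globalLoss f P wt)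
  have e : gradient (localLoss f (P k)) w - gradient (localLoss f (P l)) w'
      = -(g w - gradient (localLoss f (P k)) w) + (g w - g w')
        + (g w' - gradient (localLoss f (P l)) w') := by abel
  have h1 := hH k w hw
  have h2 := hH l w' hw'
  have h3 := (hLip w hw w' hw').trans (mul_le_mul_of_nonneg_left (hρ w hw w' hw') hΛ.le)
  rw [e]
  refine (norm_add₃_le).trans ?_
  rw [norm_neg]
  linarith

end globalLoss

/-! ### The returned average of aggregated solutions -/

theorem measurable_comp_of_lowerSemicontinuousOn {Ω E : Type*} [MeasurableSpace Ω]
    [TopologicalSpace E] [MeasurableSpace E] [BorelSpace E] {W : Set E} {φ : E → ℝ}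
    (hW : IsClosed W) (hφ : LowerSemicontinuousOn φ W) {g : Ω → E} (hg : Measurable g)
    (hgW : ∀ ω, g ω ∈ W) : Measurable fun ω => φ (g ω) := by
  refine measurable_of_Iic fun c => ?_
  obtain ⟨u, hu, he⟩ := lowerSemicontinuousOn_iff_preimage_Iic.1 hφ c
  have : (fun ω => φ (g ω)) ⁻¹' Set.Iic c = g ⁻¹' (W ∩ u) := by
    rw [← he]
    ext ω
    simp [hgW ω]
  rw [this]
  exact hg (hW.inter hu).measurableSet

theorem output_eq (I : Input p K) (O : ℕ → Fin K → Vec p → Vec p) (T : ℕ) : output I O T =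
    ∑ t ∈ Finset.range (T + 1), ((cumAlpha I.a T)⁻¹ * alpha I.a t) • serverSol I O (t + 1) := by
  simp only [output, Finset.smul_sum, mul_smul]
  rfl

theorem sum_output_weights {a : ℝ} (ha : 0 < a) (T : ℕ) :
    ∑ t ∈ Finset.range (T + 1), (cumAlpha a T)⁻¹ * alpha a t = 1 := by
  rw [← Finset.mul_sum]
  exact inv_mul_cancel₀ (cumAlpha_pos ha T).ne'

theorem output_weight_nonneg {a : ℝ} (ha : 0 < a) (T t : ℕ) :
    0 ≤ (cumAlpha a T)⁻¹ * alpha a t :=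
  mul_nonneg (inv_nonneg.2 (cumAlpha_pos ha T).le) (alpha_nonneg a t)

theorem output_mem {I : Input p K} (hI : I.Admissible) (O : ℕ → Fin K → Vec p → Vec p) (T : ℕ) :
    output I O T ∈ I.dom := by
  rw [output_eq]
  exact hI.convex.sum_mem (fun t _ => output_weight_nonneg hI.a_pos T t)
    (sum_output_weights hI.a_pos T) fun t _ => serverSol_mem O hI (t + 1)

theorem convexOn_output_le {I : Input p K} (hI : I.Admissible) (O : ℕ → Fin K → Vec p → Vec p)
    (T : ℕ) {φ : Vec p → ℝ} (hφ : ConvexOn ℝ I.dom φ) (m : ℝ) :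
    φ (output I O T) - m ≤ (cumAlpha I.a T)⁻¹ *
      ∑ t ∈ Finset.range (T + 1), alpha I.a t * (φ (serverSol I O (t + 1)) - m) := by
  have h1 := hφ.map_sum_le (t := Finset.range (T + 1))
    (w := fun t => (cumAlpha I.a T)⁻¹ * alpha I.a t) (p := fun t => serverSol I O (t + 1))
    (fun t _ => output_weight_nonneg hI.a_pos T t) (sum_output_weights hI.a_pos T)
    fun t _ => serverSol_mem O hI (t + 1)
  rw [← output_eq] at h1
  have h2 : m = ∑ t ∈ Finset.range (T + 1), (cumAlpha I.a T)⁻¹ * alpha I.a t * m := by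
    rw [← Finset.sum_mul, sum_output_weights hI.a_pos, one_mul]
  rw [Finset.mul_sum]
  simp only [mul_sub, Finset.sum_sub_distrib, ← mul_assoc]
  simp only [smul_eq_mul] at h1
  linarith

theorem cumAlpha_ge {a : ℝ} (ha : 0 < a) (T : ℕ) : (T : ℝ) ^ 3 / 3 ≤ cumAlpha a T := by
  induction T with
  | zero => simpa using (cumAlpha_pos ha 0).le
  | succ T ih =>
    have e : cumAlpha a (T + 1) = cumAlpha a T + alpha a (T + 1) := Finset.sum_range_succ _ _
    rw [e, alpha]
    push_cast
    have hT : (0 : ℝ) ≤ T := T.cast_nonneg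
    nlinarith

/-! ### Bounds in expectation -/

section expectation

variable {S Ω : Type*} [MeasurableSpace S] [MeasurableSpace Ω] {I : Input p K}
  {f : Vec p → S → ℝ} {P : Fin K → Measure S} {Pr : Measure Ω} {x : ℕ → Fin K → Ω → S} {σ : ℝ}

theorem SamplingModel.measurable_output (h : SamplingModel I f P Pr x σ) (T : ℕ) :
    Measurable fun ω => output I (oracle f x ω) T := by
  simp only [output_eq]
  exact Finset.measurable_fun_sum _ fun t _ => (h.measurable_serverSol (t + 1)).fun_const_smul _

theorem objective_lsc (hI : I.Admissible)
    (hd : ∀ k, ∀ w ∈ I.dom, DifferentiableAt ℝ (localLoss f (P k)) w) :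
    LowerSemicontinuousOn (objective f P I.wt I.reg) I.dom := by
  refine LowerSemicontinuousOn.add (ContinuousOn.lowerSemicontinuousOn ?_) hI.lsc
  refine continuousOn_finsetSum _ fun k _ => continuousOn_const.mul ?_
  exact fun w hw => (hd k w hw).continuousAt.continuousWithinAt

theorem objective_convexOn {L : ℝ} (hI : I.Admissible)
    (hF : ∀ k, StronglyConvexSmoothOn I.μ L I.dom (localLoss f (P k))) :
    ConvexOn ℝ I.dom (objective f P I.wt I.reg) := by
  refine ConvexOn.add ⟨hI.convex, fun u hu v hv a b ha hb hab => ?_⟩ hI.convexOn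
  simp only [globalLoss, smul_eq_mul, Finset.mul_sum]
  rw [← Finset.sum_add_distrib]
  refine Finset.sum_le_sum fun k _ => ?_
  have h1 := ((hF k).convexOn hI.μ_pos.le hI.convex).2 hu hv ha hb hab
  have h2 := mul_le_mul_of_nonneg_left h1 (hI.wt_nonneg k)
  simp only [smul_eq_mul] at h2
  linarith

variable [IsProbabilityMeasure Pr]

theorem SamplingModel.integrable_sq_norm_sub (h : SamplingModel I f P Pr x σ) {u v : Ω → Vec p}
    (hu : Measurable u) (hv : Measurable v) (hum : ∀ ω, u ω ∈ I.dom) (hvm : ∀ ω, v ω ∈ I.dom) :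
    Integrable (fun ω => ‖u ω - v ω‖ ^ 2) Pr := by
  obtain ⟨R, hR⟩ := h.admissible.isCompact.isBounded.exists_norm_le
  refine Integrable.of_bound ((hu.sub hv).norm.pow_const 2).aestronglyMeasurable ((R + R) ^ 2)
    (Filter.Eventually.of_forall fun ω => ?_)
  rw [Real.norm_of_nonneg (sq_nonneg _)]
  exact pow_le_pow_left₀ (norm_nonneg _)
    ((norm_sub_le _ _).trans (add_le_add (hR _ (hum ω)) (hR _ (hvm ω)))) 2

theorem SamplingModel.integrable_discrepancy (h : SamplingModel I f P Pr x σ) (t : ℕ) :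
    Integrable (fun ω => discrepancy I (oracle f x ω) t) Pr := by
  refine integrable_finsetSum _ fun k _ => Integrable.const_mul ?_ _
  exact h.integrable_sq_norm_sub (h.measurable_localSol t k) (h.measurable_serverSol t)
    (fun ω => localSol_mem _ h.admissible t k) (fun ω => serverSol_mem _ h.admissible t)

variable [∀ k, IsProbabilityMeasure (P k)]

/-- With s = t + a, the powers of s cancel: s² from α_t, s⁴ from the squared weights in the window,
s⁻⁶ from the modulus. The constant is 288 · 9, the noise factor 4 being enlarged to 9. -/
theorem SamplingModel.integral_discrepancy_le (h : SamplingModel I f P Pr x σ) (hE : 1 ≤ I.gap)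
    (hγ : I.γ = 2 * I.μ * I.a ^ 3) (ha : 4 ≤ I.a) {G : ℝ}
    (hG : ∀ k l, ∀ w ∈ I.dom, ∀ w' ∈ I.dom,
      ‖gradient (localLoss f (P k)) w - gradient (localLoss f (P l)) w'‖ ≤ 2 * G)
    (hμG : ∀ w ∈ I.dom, ∀ w' ∈ I.dom, I.μ * ‖w - w'‖ ≤ 2 * G) (t : ℕ) :
    alpha I.a t * ∫ ω, discrepancy I (oracle f x ω) t ∂Pr ≤
      2592 / I.μ ^ 2 * (I.gap * σ ^ 2 + I.gap ^ 2 * G ^ 2) := by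
  have hI := h.admissible
  have hμ := hI.μ_pos
  cases t with
  | zero =>
    simp only [discrepancy_zero, integral_zero, mul_zero]
    positivity
  | succ t =>
    have hs : 0 < ((t + 1 : ℕ) : ℝ) + I.a := add_pos_of_nonneg_of_pos (Nat.cast_nonneg _) hI.a_pos
    set s := ((t + 1 : ℕ) : ℝ) + I.a
    set c := 288 / (I.μ ^ 2 * s ^ 6)
    have hc : 0 ≤ c := by positivity
    have hαs : alpha I.a t ≤ s ^ 2 := alpha_mono hI.a_pos (Nat.le_succ t)
    have hα2 : alpha I.a t ^ 2 ≤ s ^ 4 := by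
      have := pow_le_pow_left₀ (alpha_nonneg I.a t) hαs 2
      linarith [this, (by ring : (s ^ 2) ^ 2 = s ^ 4)]
    have hJ : ∑ i ∈ Finset.Ico (t - t % I.gap) (t + 1), alpha I.a i ^ 2 ≤ I.gap * s ^ 4 := by
      calc ∑ i ∈ Finset.Ico (t - t % I.gap) (t + 1), alpha I.a i ^ 2
          ≤ ∑ i ∈ Finset.Ico (t - t % I.gap) (t + 1), s ^ 4 := by
            refine Finset.sum_le_sum fun i hi => le_trans ?_ hα2
            have hit : i ≤ t := by have := (Finset.mem_Ico.1 hi).2; omega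
            exact pow_le_pow_left₀ (alpha_nonneg _ _) (alpha_mono hI.a_pos hit) 2
        _ ≤ I.gap * s ^ 4 := by
            rw [Finset.sum_const, nsmul_eq_mul]
            refine mul_le_mul_of_nonneg_right ?_ (by positivity)
            exact_mod_cast card_Ico_mod_le hE t
    have hk : ∀ k, ∫ ω, ‖localSol I (oracle f x ω) (t + 1) k
        - serverSol I (oracle f x ω) (t + 1)‖ ^ 2 ∂Pr ≤
          c * s ^ 4 * (9 * (I.gap * σ ^ 2 + I.gap ^ 2 * G ^ 2)) := by
      intro k
      have h1 := h.sq_sum_sampleNoise_sub_wmean (Finset.Ico (t - t % I.gap) (t + 1)) (alpha I.a) k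
      have h2 : ∀ ω, ‖localSol I (oracle f x ω) (t + 1) k
          - serverSol I (oracle f x ω) (t + 1)‖ ^ 2 ≤
          c * (‖∑ i ∈ Finset.Ico (t - t % I.gap) (t + 1), alpha I.a i •
            (sampleNoise I f P x i k ω - I.wmean (fun l => sampleNoise I f P x i l ω))‖ ^ 2
            + 9 * I.gap ^ 2 * alpha I.a t ^ 2 * G ^ 2) := fun ω =>
        sq_dist_localSol_serverSol_le (oracle f x ω) hI hE hγ ha hG hμG t k
      refine (integral_mono ?_ ((h1.1.add (integrable_const _)).const_mul c) h2).trans ?_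
      · exact h.integrable_sq_norm_sub (h.measurable_localSol (t + 1) k)
          (h.measurable_serverSol (t + 1)) (fun ω => localSol_mem _ hI _ k)
          (fun ω => serverSol_mem _ hI _)
      · rw [integral_const_mul]
        simp only [Pi.add_apply]
        rw [integral_add h1.1 (integrable_const _), integral_const, probReal_univ, one_smul,
          mul_assoc c]
        refine mul_le_mul_of_nonneg_left ?_ hc
        have h3 := mul_le_mul_of_nonneg_right hJ (sq_nonneg σ)
        have h4 := mul_le_mul_of_nonneg_right hα2 (by positivity : 0 ≤ (I.gap : ℝ) ^ 2 * G ^ 2)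
        have h5 : 0 ≤ (I.gap : ℝ) * s ^ 4 * σ ^ 2 := by positivity
        linarith [h1.2]
    have hsum : ∫ ω, discrepancy I (oracle f x ω) (t + 1) ∂Pr ≤
        c * s ^ 4 * (9 * (I.gap * σ ^ 2 + I.gap ^ 2 * G ^ 2)) := by
      unfold discrepancy
      rw [integral_finsetSum]
      · calc ∑ k, ∫ ω, I.wt k * ‖localSol I (oracle f x ω) (t + 1) k
              - serverSol I (oracle f x ω) (t + 1)‖ ^ 2 ∂Pr
            ≤ ∑ k, I.wt k * (c * s ^ 4 * (9 * (I.gap * σ ^ 2 + I.gap ^ 2 * G ^ 2))) := by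
              refine Finset.sum_le_sum fun k _ => ?_
              rw [integral_const_mul]
              exact mul_le_mul_of_nonneg_left (hk k) (hI.wt_nonneg k)
          _ = _ := by rw [← Finset.sum_mul, hI.wt_sum, one_mul]
      · intro k _
        exact (h.integrable_sq_norm_sub (h.measurable_localSol (t + 1) k)
          (h.measurable_serverSol (t + 1)) (fun ω => localSol_mem _ hI _ k)
          (fun ω => serverSol_mem _ hI _)).const_mul _
    refine (mul_le_mul_of_nonneg_left hsum (alpha_nonneg I.a (t + 1))).trans_eq ?_
    change s ^ 2 * _ = _
    simp only [c]
    field_simp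
    ring

theorem SamplingModel.integral_inner_wmean_sampleNoise (h : SamplingModel I f P Pr x σ) (t : ℕ)
    {u : Vec p} (hu : u ∈ I.dom) :
    Integrable (fun ω => inner ℝ (I.wmean fun k => sampleNoise I f P x t k ω)
        (u - serverSol I (oracle f x ω) t)) Pr ∧
      ∫ ω, inner ℝ (I.wmean fun k => sampleNoise I f P x t k ω)
        (u - serverSol I (oracle f x ω) t) ∂Pr = 0 := by
  have hv : Measurable fun ω => u - serverSol I (oracle f x ω) t :=
    measurable_const.sub (h.measurable_serverSol t)
  have hv2 := h.integrable_sq_norm_sub measurable_const (h.measurable_serverSol t) (fun _ => hu)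
    (fun ω => serverSol_mem _ h.admissible t)
  have hint : ∀ k, Integrable (fun ω => inner ℝ (I.wt k • sampleNoise I f P x t k ω)
      (u - serverSol I (oracle f x ω) t)) Pr := by
    intro k
    simp only [real_inner_smul_left]
    exact (integrable_inner_of_sq (h.measurable_sampleNoise t k) hv
      (h.sq_sampleNoise t k).1 hv2).const_mul _
  simp only [Input.wmean, sum_inner]
  refine ⟨integrable_finsetSum _ fun k _ => hint k, ?_⟩
  rw [integral_finsetSum _ fun k _ => hint k]
  refine Finset.sum_eq_zero fun k _ => ?_
  simp only [real_inner_smul_left]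
  rw [integral_const_mul, h.integral_inner_sampleNoise t k hv hv2, mul_zero]
  refine Measurable.sub (@measurable_const _ _ _ _ u) ?_
  refine (measurable_run h.admissible h.measurable_loss h.differentiableAt_loss t
    fun i hi l => ?_).2.2.2
  refine Measurable.of_comap_le ?_
  exact le_iSup₂_of_le (f := fun (i : ℕ × Fin K) (_ : i ∈ ({(t, k)}ᶜ : Set (ℕ × Fin K))) =>
    MeasurableSpace.comap (x i.1 i.2) inferInstance) (i, l) (by simp; omega) le_rfl

theorem SamplingModel.expected_suboptimality (h : SamplingModel I f P Pr x σ) (hE : 1 ≤ I.gap)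
    (hγ : I.γ = 2 * I.μ * I.a ^ 3) (ha : 4 ≤ I.a) {L : ℝ} (hL : 0 ≤ L)
    (hLa : 4 * L ≤ I.μ * I.a)
    (hF : ∀ k, StronglyConvexSmoothOn I.μ L I.dom (localLoss f (P k))) {G : ℝ}
    (hG : ∀ k l, ∀ w ∈ I.dom, ∀ w' ∈ I.dom,
      ‖gradient (localLoss f (P k)) w - gradient (localLoss f (P l)) w'‖ ≤ 2 * G)
    (hμG : ∀ w ∈ I.dom, ∀ w' ∈ I.dom, I.μ * ‖w - w'‖ ≤ 2 * G) {u : Vec p} (hu : u ∈ I.dom)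
    (hmin : IsMinOn (objective f P I.wt I.reg) I.dom u) (T : ℕ) :
    Integrable (fun ω => objective f P I.wt I.reg (output I (oracle f x ω) T)
        - objective f P I.wt I.reg u) Pr ∧
      ∫ ω, (objective f P I.wt I.reg (output I (oracle f x ω) T)
        - objective f P I.wt I.reg u) ∂Pr ≤
      (cumAlpha I.a T)⁻¹ * (I.μ * I.a ^ 3 * ‖I.init - u‖ ^ 2 +
        (T + 1) * (48 * (T + I.a) / I.μ * ∑ k, I.wt k ^ 2 * σ ^ 2
          + L * (2592 / I.μ ^ 2 * (I.gap * σ ^ 2 + I.gap ^ 2 * G ^ 2)))) := by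
  have hI := h.admissible
  have hA := cumAlpha_pos hI.a_pos T
  have hμ := hI.μ_pos
  let R : ℕ → Ω → ℝ := fun t ω =>
    alpha I.a t * inner ℝ (I.wmean fun k => sampleNoise I f P x t k ω)
        (u - serverSol I (oracle f x ω) t)
      + 48 * (t + I.a) / I.μ * ‖I.wmean (fun k => sampleNoise I f P x t k ω)‖ ^ 2
      + L * (alpha I.a t * discrepancy I (oracle f x ω) t)
  have hi1 := fun t => (h.integral_inner_wmean_sampleNoise t hu).1.const_mul (alpha I.a t)
  have hi2 := fun t : ℕ => (h.sq_wmean_sampleNoise t).1.const_mul (48 * (t + I.a) / I.μ)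
  have hi3 := fun t => ((h.integrable_discrepancy t).const_mul (alpha I.a t)).const_mul L
  have hRint : ∀ t, Integrable (R t) Pr := fun t => ((hi1 t).add (hi2 t)).add (hi3 t)
  have hRle : ∀ t ∈ Finset.range (T + 1), ∫ ω, R t ω ∂Pr ≤
      48 * (T + I.a) / I.μ * ∑ k, I.wt k ^ 2 * σ ^ 2
        + L * (2592 / I.μ ^ 2 * (I.gap * σ ^ 2 + I.gap ^ 2 * G ^ 2)) := by
    intro t ht
    have htT : (t : ℝ) ≤ T := by exact_mod_cast Nat.lt_succ_iff.1 (Finset.mem_range.1 ht)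
    have e : ∫ ω, R t ω ∂Pr = 48 * (t + I.a) / I.μ *
        ∫ ω, ‖I.wmean (fun k => sampleNoise I f P x t k ω)‖ ^ 2 ∂Pr
        + L * (alpha I.a t * ∫ ω, discrepancy I (oracle f x ω) t ∂Pr) := by
      refine (integral_add ((hi1 t).add (hi2 t)) (hi3 t)).trans ?_
      rw [integral_add' (hi1 t) (hi2 t), integral_const_mul, integral_const_mul, integral_const_mul, integral_const_mul,
        (h.integral_inner_wmean_sampleNoise t hu).2, mul_zero, zero_add]
    rw [e]
    have ha0 := hI.a_pos
    have h0 : 0 ≤ ∑ k, I.wt k ^ 2 * σ ^ 2 := Finset.sum_nonneg fun k _ => by positivity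
    refine add_le_add ?_ (mul_le_mul_of_nonneg_left
      (h.integral_discrepancy_le hE hγ ha hG hμG t) hL)
    refine (mul_le_mul_of_nonneg_left (h.sq_wmean_sampleNoise t).2 (by positivity)).trans ?_
    gcongr
  have hpath : ∀ ω, objective f P I.wt I.reg (output I (oracle f x ω) T)
        - objective f P I.wt I.reg u ≤ (cumAlpha I.a T)⁻¹ *
      (I.μ * I.a ^ 3 * ‖I.init - u‖ ^ 2 + ∑ t ∈ Finset.range (T + 1), R t ω) := fun ω =>
    (convexOn_output_le hI (oracle f x ω) T (objective_convexOn hI hF) _).trans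
      (mul_le_mul_of_nonneg_left (weighted_objective_sub_le (oracle f x ω) hI hγ ha hL hLa hF
        (T + 1) hu) (inv_nonneg.2 hA.le))
  have hsumint : Integrable (fun ω => ∑ t ∈ Finset.range (T + 1), R t ω) Pr :=
    integrable_finsetSum _ fun t _ => hRint t
  have hbound : Integrable (fun ω => (cumAlpha I.a T)⁻¹ *
      (I.μ * I.a ^ 3 * ‖I.init - u‖ ^ 2 + ∑ t ∈ Finset.range (T + 1), R t ω)) Pr :=
    ((integrable_const _).add hsumint).const_mul _
  have hm : Measurable fun ω => objective f P I.wt I.reg (output I (oracle f x ω) T)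
        - objective f P I.wt I.reg u :=
    (measurable_comp_of_lowerSemicontinuousOn hI.isCompact.isClosed
      (objective_lsc hI h.differentiableAt_localLoss) (h.measurable_output T)
      (fun ω => output_mem hI _ T)).sub_const _
  -- The regularizer is not assumed bounded on the domain. The gap is nonnegative by minimality of
  -- `u`, hence squeezed between 0 and the integrable pathwise bound.
  have hint : Integrable (fun ω => objective f P I.wt I.reg (output I (oracle f x ω) T)
        - objective f P I.wt I.reg u) Pr := by
    refine hbound.mono' hm.aestronglyMeasurable (Filter.Eventually.of_forall fun ω => ?_)
    rw [Real.norm_of_nonneg (sub_nonneg.2 (hmin (output_mem hI _ T)))]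
    exact hpath ω
  refine ⟨hint, (integral_mono hint hbound hpath).trans ?_⟩
  rw [integral_const_mul, integral_add (integrable_const _) hsumint, integral_const, probReal_univ,
    one_smul, integral_finsetSum _ fun t _ => hRint t]
  refine mul_le_mul_of_nonneg_left (add_le_add_right ?_ _) (inv_nonneg.2 hA.le)
  refine (Finset.sum_le_sum hRle).trans_eq ?_
  rw [Finset.sum_const, Finset.card_range, nsmul_eq_mul]
  push_cast
  ring

end expectation

/-! ### Arithmetic of the rate, the speedup and the communication -/

theorem rate_bound {μ L a B s v w : ℝ} {E T : ℕ} (hμ : 0 < μ) (hL : 0 ≤ L) (ha : 4 ≤ a)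
    (hT : a ≤ T) (hs : 0 ≤ s) (hB : 0 ≤ B) (hv : 0 ≤ v) (hw : 0 ≤ w) :
    (cumAlpha a T)⁻¹ * (μ * a ^ 3 * B + (T + 1) * (48 * (T + a) / μ * s
        + L * (2592 / μ ^ 2 * (E * v + E ^ 2 * w)))) ≤
      15552 * (μ * a ^ 3 * B / T ^ 3 + s / (μ * T) + L * E * v / (μ ^ 2 * T ^ 2)
        + L * E ^ 2 * w / (μ ^ 2 * T ^ 2)) := by
  have ha0 : 0 < a := by linarith
  have hT0 : 0 < (T : ℝ) := by linarith
  have hA : (cumAlpha a T)⁻¹ ≤ 3 / T ^ 3 := by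
    rw [← inv_div]
    exact inv_anti₀ (by positivity) (cumAlpha_ge ha0 T)
  -- Since 1 ≤ a ≤ T, both T + 1 and T + a are at most 2T. The largest resulting constant is 3 · 2 ·
  -- 2592 = 15552.
  have h1 : μ * a ^ 3 * B + (T + 1) * (48 * (T + a) / μ * s
        + L * (2592 / μ ^ 2 * (E * v + E ^ 2 * w))) ≤
      μ * a ^ 3 * B + 2 * T * (48 * (2 * T) / μ * s
        + L * (2592 / μ ^ 2 * (E * v + E ^ 2 * w))) := by
    gcongr <;> linarith
  refine (mul_le_mul hA h1 (by positivity) (by positivity)).trans ?_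
  have e : 3 / (T : ℝ) ^ 3 * (μ * a ^ 3 * B + 2 * T * (48 * (2 * T) / μ * s
        + L * (2592 / μ ^ 2 * (E * v + E ^ 2 * w)))) =
      3 * (μ * a ^ 3 * B / T ^ 3) + 576 * (s / (μ * T)) + 15552 * (L * E * v / (μ ^ 2 * T ^ 2))
        + 15552 * (L * E ^ 2 * w / (μ ^ 2 * T ^ 2)) := by
    field_simp
    ring
  rw [e]
  have h2 : 0 ≤ μ * a ^ 3 * B / T ^ 3 := by positivity
  have h3 : 0 ≤ s / (μ * T) := by positivity
  linarith

theorem speedup_bound {μ L K T σ G C E a B : ℝ} (hμ : 0 < μ) (hL : 0 < L) (hK : 0 < K)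
    (hT : 0 < T) (hσ : 0 < σ) (hG : 0 < G) (hC : 1 ≤ C)
    (h1 : E ^ 2 ≤ C * (σ ^ 2 * μ * T / (L * K * G ^ 2)))
    (h2 : μ ^ 2 * a ^ 3 * B * K / σ ^ 2 ≤ C * T ^ 2)
    (h3 : L * K * σ ^ 2 / (μ * G ^ 2) ≤ C * T) :
    μ * a ^ 3 * B / T ^ 3 + σ ^ 2 / K / (μ * T) + L * E * σ ^ 2 / (μ ^ 2 * T ^ 2)
      + L * E ^ 2 * G ^ 2 / (μ ^ 2 * T ^ 2) ≤ 4 * C * (σ ^ 2 / (μ * K * T)) := by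
  set q := σ ^ 2 / (μ * K * T)
  have hq : 0 < q := by positivity
  have hC0 : 0 < C := by linarith
  have t1 : μ * a ^ 3 * B / T ^ 3 ≤ C * q := by
    have e : μ * a ^ 3 * B / T ^ 3 = μ ^ 2 * a ^ 3 * B * K / σ ^ 2 * (q / T ^ 2) := by
      simp only [q]; field_simp
    rw [e]
    refine (mul_le_mul_of_nonneg_right h2 (by positivity)).trans_eq ?_
    field_simp
  have t2 : σ ^ 2 / K / (μ * T) ≤ C * q := by
    have e : σ ^ 2 / K / (μ * T) = 1 * q := by simp only [q]; field_simp
    rw [e]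
    exact mul_le_mul_of_nonneg_right hC hq.le
  have t4 : L * E ^ 2 * G ^ 2 / (μ ^ 2 * T ^ 2) ≤ C * q := by
    have e : L * E ^ 2 * G ^ 2 / (μ ^ 2 * T ^ 2) = E ^ 2 * (L * G ^ 2 / (μ ^ 2 * T ^ 2)) := by ring
    rw [e]
    refine (mul_le_mul_of_nonneg_right h1 (by positivity)).trans_eq ?_
    simp only [q]; field_simp
  -- Multiplying `h1` by `h3` cancels σ and G; this controls the term linear in E.
  have hLEK : L * K * E ≤ C * μ * T := by
    refine le_of_sq_le_sq ?_ (by positivity)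
    calc (L * K * E) ^ 2 = (L * K) ^ 2 * E ^ 2 := by ring
      _ ≤ (L * K) ^ 2 * (C * (σ ^ 2 * μ * T / (L * K * G ^ 2))) :=
          mul_le_mul_of_nonneg_left h1 (sq_nonneg _)
      _ = C * μ ^ 2 * T * (L * K * σ ^ 2 / (μ * G ^ 2)) := by field_simp
      _ ≤ C * μ ^ 2 * T * (C * T) := mul_le_mul_of_nonneg_left h3 (by positivity)
      _ = (C * μ * T) ^ 2 := by ring
  have t3 : L * E * σ ^ 2 / (μ ^ 2 * T ^ 2) ≤ C * q := by
    have e : L * E * σ ^ 2 / (μ ^ 2 * T ^ 2) = L * K * E * (q / (μ * T)) := by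
      simp only [q]; field_simp
    rw [e]
    refine (mul_le_mul_of_nonneg_right hLEK (by positivity)).trans_eq ?_
    field_simp
  linarith

theorem commRounds_le (E T : ℕ) : (commRounds E T : ℝ) ≤ (T + 1) / E := by
  have h : commRounds E T = (T + 1) / E := by
    rw [← Nat.card_multiples]
    rfl
  rw [h]
  exact_mod_cast Nat.cast_div_le (α := ℝ) (m := T + 1) (n := E)

theorem exists_gap {μ L K σ G : ℝ} {T : ℕ} (hμ : 0 < μ) (hL : 0 < L) (hK : 0 < K)
    (hT : 1 ≤ (T : ℝ)) (hσ : 0 < σ) (hG : 0 < G) (h : L * K * G ^ 2 / (μ * σ ^ 2) ≤ T) :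
    ∃ E : ℕ, 1 ≤ E ∧ (E : ℝ) ^ 2 ≤ σ ^ 2 * μ * T / (L * K * G ^ 2) ∧
      (commRounds E T : ℝ) ≤ 4 * (Real.sqrt (L / μ) * G / σ) * Real.sqrt (T * K) := by
  set y := σ ^ 2 * μ * T / (L * K * G ^ 2)
  have hy : 1 ≤ y := by
    rw [div_le_iff₀ (by positivity)] at h
    rw [le_div_iff₀ (by positivity)]
    linarith
  have hx : 1 ≤ Real.sqrt y := Real.one_le_sqrt.2 hy
  -- The gap is the largest integer with E² ≤ y, and `h` says exactly that y ≥ 1. Rounding down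
  -- costs a factor 2 and T + 1 ≤ 2T another, whence the 4.
  have hE : 1 ≤ ⌊Real.sqrt y⌋₊ := Nat.le_floor (by simpa using hx)
  have hfl : (⌊Real.sqrt y⌋₊ : ℝ) ≤ Real.sqrt y := Nat.floor_le (Real.sqrt_nonneg y)
  have hlt : Real.sqrt y < ⌊Real.sqrt y⌋₊ + 1 := Nat.lt_floor_add_one _
  have hE1 : (1 : ℝ) ≤ ⌊Real.sqrt y⌋₊ := by exact_mod_cast hE
  refine ⟨_, hE, ?_, (commRounds_le _ T).trans ?_⟩
  · calc (⌊Real.sqrt y⌋₊ : ℝ) ^ 2 ≤ Real.sqrt y ^ 2 := pow_le_pow_left₀ (Nat.cast_nonneg _) hfl 2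
      _ = y := Real.sq_sqrt (by linarith)
  · have hprod : Real.sqrt (L / μ) * G / σ * Real.sqrt (T * K) * Real.sqrt y = T := by
      rw [mul_assoc, ← Real.sqrt_mul (by positivity), div_mul_eq_mul_div, mul_right_comm,
        ← Real.sqrt_mul (by positivity)]
      have e : L / μ * (T * K * y) = (T * σ / G) ^ 2 := by
        simp only [y]; field_simp
      rw [e, Real.sqrt_sq (by positivity)]
      field_simp
    have hq : 0 ≤ Real.sqrt (L / μ) * G / σ * Real.sqrt (T * K) := by positivity
    rw [div_le_iff₀ (by linarith)]
    have h2 : Real.sqrt y ≤ 2 * ⌊Real.sqrt y⌋₊ := by linarith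
    have h3 := mul_le_mul_of_nonneg_left h2 hq
    rw [hprod] at h3
    linarith

end FedComposite

/-! ### Assembly of the theorem -/

open FedComposite in
theorem theorem1 :
    ∃ c : ℝ, 0 < c ∧
      ∀ (p K : ℕ) (S : Type*) [MeasurableSpace S] (Ω : Type*) [MeasurableSpace Ω]
        (Pr : Measure Ω) [IsProbabilityMeasure Pr]
        -- loss, data laws of the clients, client weights
        (f : Vec p → S → ℝ) (P : Fin K → Measure S) [∀ k, IsProbabilityMeasure (P k)]
        (wt : Fin K → ℝ) (_ : ∀ k, 0 ≤ wt k) (_ : ∑ k, wt k = 1)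
        -- the domain is the closed ball of radius `ρ`, and `h` is closed and convex on it
        (ρ : ℝ) (_ : 0 < ρ) (W : Set (Vec p)) (_ : W = Metric.closedBall 0 ρ)
        (h : Vec p → ℝ) (_ : ConvexOn ℝ W h) (_ : LowerSemicontinuousOn h W)
        -- the loss is measurable, integrable, and differentiable at the points of the domain
        (_ : Measurable (Function.uncurry f))
        (_ : ∀ k, ∀ w ∈ W, Integrable (f w) (P k))
        (_ : ∀ s, ∀ w ∈ W, DifferentiableAt ℝ (fun v => f v s) w)
        -- strong convexity and smoothness of the local losses
        (μ L : ℝ) (_ : 0 < μ) (_ : μ ≤ L)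
        (_ : ∀ k, StronglyConvexSmoothOn μ L W (localLoss f (P k)))
        -- smoothness of the global loss and bounded heterogeneity
        (Λ H : ℝ) (_ : 0 < Λ) (_ : 0 ≤ H)
        (_ : ∀ w ∈ W, ∀ w' ∈ W,
          ‖gradient (globalLoss f P wt) w - gradient (globalLoss f P wt) w'‖ ≤ Λ * ‖w - w'‖)
        (_ : ∀ k, ∀ w ∈ W,
          ‖gradient (globalLoss f P wt) w - gradient (localLoss f (P k)) w‖ ≤ H)
        -- unbiased stochastic gradients with bounded variance
        (σ : ℝ) (_ : 0 ≤ σ) (_ : ∀ k, UnbiasedBoundedVariance f (P k) W σ)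
        -- independent samples `x t k` with law `P k`
        (x : ℕ → Fin K → Ω → S) (_ : ∀ t k, Measurable (x t k))
        (_ : ∀ t k, Measure.map (x t k) Pr = P k)
        (_ : iIndepFun (fun i : ℕ × Fin K => x i.1 i.2) Pr)
        -- initial point, minimizer, and the parameter `a`
        (w₀ : Vec p) (_ : w₀ ∈ W)
        (wmin : Vec p) (_ : wmin ∈ W) (_ : IsMinOn (objective f P wt h) W wmin)
        (a : ℝ) (_ : 4 * L / μ ≤ a),
        -- the convergence rate
        (∀ E T : ℕ, 1 ≤ E → a ≤ T →
          Integrable (suboptimality f P wt W h w₀ μ a x wmin E T) Pr ∧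
          ∫ ω, suboptimality f P wt W h w₀ μ a x wmin E T ω ∂Pr ≤
            c * (μ * a ^ 3 * ‖w₀ - wmin‖ ^ 2 / T ^ 3
              + (∑ k, wt k ^ 2 * σ ^ 2) / (μ * T)
              + L * E * σ ^ 2 / (μ ^ 2 * T ^ 2)
              + L * E ^ 2 * (H + Λ * ρ) ^ 2 / (μ ^ 2 * T ^ 2))) ∧
        -- linear speedup for equal weights
        ((∀ k, wt k = 1 / K) → 0 < σ →
          ∀ (C : ℝ) (E T : ℕ), 1 ≤ C → 1 ≤ E → a ≤ T →
            (E : ℝ) ^ 2 ≤ C * (σ ^ 2 * μ * T / (L * K * (H + Λ * ρ) ^ 2)) →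
            μ ^ 2 * a ^ 3 * ‖w₀ - wmin‖ ^ 2 * K / σ ^ 2 ≤ C * T ^ 2 →
            L * K * σ ^ 2 / (μ * (H + Λ * ρ) ^ 2) ≤ C * T →
            ∫ ω, suboptimality f P wt W h w₀ μ a x wmin E T ω ∂Pr ≤ c * C * (σ ^ 2 / (μ * K * T))) ∧
        -- linear speedup with `O(√(TK))` communication rounds
        ((∀ k, wt k = 1 / K) → 0 < σ →
          ∀ T : ℕ, a ≤ T →
            μ ^ 2 * a ^ 3 * ‖w₀ - wmin‖ ^ 2 * K / σ ^ 2 ≤ T ^ 2 →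
            L * K * σ ^ 2 / (μ * (H + Λ * ρ) ^ 2) ≤ T →
            L * K * (H + Λ * ρ) ^ 2 / (μ * σ ^ 2) ≤ T →
            ∃ E : ℕ, 1 ≤ E ∧
              ∫ ω, suboptimality f P wt W h w₀ μ a x wmin E T ω ∂Pr ≤ c * (σ ^ 2 / (μ * K * T)) ∧
              (commRounds E T : ℝ) ≤
                c * (Real.sqrt (L / μ) * (H + Λ * ρ) / σ) * Real.sqrt (T * K)) := by
  -- This is 4 · 15552: the constant of `rate_bound` times the number of terms in `speedup_bound`.
  refine ⟨62208, by norm_num, ?_⟩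
  intro p K S _ Ω _ Pr _ f P _ wt hwt hwt1 ρ hρ W hW h hconv hlsc hf _ hd μ L hμ hμL hF Λ H hΛ hH
    hLip hHet σ hσ hunb x hx hxP hind w₀ hw₀ wmin hwmin hmin a ha
  have hL : 0 < L := hμ.trans_le hμL
  have hLa : 4 * L ≤ μ * a := by rw [div_le_iff₀ hμ] at ha; linarith
  have ha4 : 4 ≤ a := by
    refine le_trans ?_ ha
    rw [le_div_iff₀ hμ]
    linarith
  have ha0 : 0 < a := by linarith
  have hdiam : ∀ w ∈ W, ∀ w' ∈ W, ‖w - w'‖ ≤ 2 * ρ := by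
    intro w hw w' hw'
    rw [hW, mem_closedBall_zero_iff] at hw hw'
    linarith [norm_sub_le w w']
  have hG0 : 0 < H + Λ * ρ := by positivity
  have hG : ∀ k l, ∀ w ∈ W, ∀ w' ∈ W,
      ‖gradient (localLoss f (P k)) w - gradient (localLoss f (P l)) w'‖ ≤ 2 * (H + Λ * ρ) :=
    fun k l w hw w' hw' => norm_gradient_localLoss_sub_le hΛ hLip hHet hdiam k l hw hw'
  have hμG : ∀ w ∈ W, ∀ w' ∈ W, μ * ‖w - w'‖ ≤ 2 * (H + Λ * ρ) := by
    intro w hw w' hw'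
    have h1 := mul_norm_sub_le_norm_gradient_globalLoss_sub hwt hwt1 hF hw hw'
    have h2 := hLip w hw w' hw'
    have h3 := mul_le_mul_of_nonneg_left (hdiam w hw w' hw') hΛ.le
    linarith
  have hrate : ∀ E T : ℕ, 1 ≤ E → a ≤ T →
      Integrable (suboptimality f P wt W h w₀ μ a x wmin E T) Pr ∧
      ∫ ω, suboptimality f P wt W h w₀ μ a x wmin E T ω ∂Pr ≤
        15552 * (μ * a ^ 3 * ‖w₀ - wmin‖ ^ 2 / T ^ 3
          + (∑ k, wt k ^ 2 * σ ^ 2) / (μ * T)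
          + L * E * σ ^ 2 / (μ ^ 2 * T ^ 2)
          + L * E ^ 2 * (H + Λ * ρ) ^ 2 / (μ ^ 2 * T ^ 2)) := by
    intro E T hE hT
    let I : Input p K :=
      { wt := wt, dom := W, reg := h, init := w₀, gap := E, μ := μ, γ := 2 * μ * a ^ 3, a := a }
    have hI : I.Admissible :=
      { wt_nonneg := hwt
        wt_sum := hwt1
        isCompact := by change IsCompact W; rw [hW]; exact isCompact_closedBall 0 ρ
        init_mem := hw₀
        convexOn := hconv
        lsc := hlsc
        μ_pos := hμ
        γ_pos := by positivity
        a_pos := ha0 }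
    have hM : SamplingModel I f P Pr x σ :=
      { admissible := hI
        measurable_loss := hf
        differentiableAt_loss := hd
        differentiableAt_localLoss := fun k => (hF k).1
        unbiased := hunb
        measurable_sample := hx
        map_sample := hxP
        indep := hind }
    have hmain := hM.expected_suboptimality hE rfl ha4 hL.le hLa hF hG hμG hwmin hmin T
    exact ⟨hmain.1, hmain.2.trans (rate_bound hμ hL.le ha4 hT
      (Finset.sum_nonneg fun k _ => by positivity) (sq_nonneg _) (sq_nonneg _) (sq_nonneg _))⟩
  have hspeed : (∀ k, wt k = 1 / K) → 0 < σ →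
      ∀ (C : ℝ) (E T : ℕ), 1 ≤ C → 1 ≤ E → a ≤ T →
        (E : ℝ) ^ 2 ≤ C * (σ ^ 2 * μ * T / (L * K * (H + Λ * ρ) ^ 2)) →
        μ ^ 2 * a ^ 3 * ‖w₀ - wmin‖ ^ 2 * K / σ ^ 2 ≤ C * T ^ 2 →
        L * K * σ ^ 2 / (μ * (H + Λ * ρ) ^ 2) ≤ C * T →
        ∫ ω, suboptimality f P wt W h w₀ μ a x wmin E T ω ∂Pr
          ≤ 62208 * C * (σ ^ 2 / (μ * K * T)) := by
    intro hwK hσ0 C E T hC hE hT h1 h2 h3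
    have hK : 0 < (K : ℝ) := by
      rcases Nat.eq_zero_or_pos K with rfl | hK
      · simp at hwt1
      · exact_mod_cast hK
    have hT0 : 0 < (T : ℝ) := ha0.trans_le hT
    refine (hrate E T hE hT).2.trans ?_
    have hs : ∑ k, wt k ^ 2 * σ ^ 2 = σ ^ 2 / K := by
      simp only [hwK, Finset.sum_const, Finset.card_univ, Fintype.card_fin, nsmul_eq_mul]
      field_simp
    rw [hs]
    have := speedup_bound hμ hL hK hT0 hσ0 hG0 hC h1 h2 h3
    linarith
  refine ⟨fun E T hE hT => ⟨(hrate E T hE hT).1, (hrate E T hE hT).2.trans ?_⟩, hspeed, ?_⟩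
  · have hT0 : 0 < (T : ℝ) := ha0.trans_le hT
    have : 0 ≤ ∑ k, wt k ^ 2 * σ ^ 2 := Finset.sum_nonneg fun k _ => by positivity
    refine mul_le_mul_of_nonneg_right (by norm_num) (by positivity)
  · intro hwK hσ0 T hT h2 h3 h4
    have hK : 0 < (K : ℝ) := by
      rcases Nat.eq_zero_or_pos K with rfl | hK
      · simp at hwt1
      · exact_mod_cast hK
    have hT1 : 1 ≤ (T : ℝ) := by linarith
    obtain ⟨E, hE, hE1, hE2⟩ := exists_gap hμ hL hK hT1 hσ0 hG0 h4
    refine ⟨E, hE, ?_, hE2.trans ?_⟩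
    · have := hspeed hwK hσ0 1 E T le_rfl hE hT (by linarith) (by linarith) (by linarith)
      linarith
    · gcongr
      norm_num
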